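/- For $f\in L^2(0,1)$ let $(Af)(x)=\int_0^x \frac{f(y)}{\sqrt{x-y}}\,dy$ ($0\le x\le 1$) denote its Abel transform. Let $d\mu(x)=\frac{dx}{\sqrt{x(1-x)}}$ on $(0,1)$, let $L^2_\mu(0,1)$ be the corresponding real $L^2$ space, and for an integer $k\ge 0$ let $H^k_\mu(0,1)$ be the space of all $g\in L^2_\mu(0,1)$ whose weak derivatives of all orders $j\le k$ exist and lie in $L^2_\mu(0,1)$. Let $\overline P_n(x)=\sqrt{2n+1}\,P_n(2x-1)$, where $P_n$ is the $n$-th Legendre polynomial. For $h\in L^2_\mu(0,1)$ put $$\eta_h(t)=\frac{\operatorname{sgn}(t)}{2\pi i}\,e^{it/2}\,h\!\left(\sin^2\tfrac t2\right)\ (-\pi\le t<\pi),\qquad c_n(h)=(-1)^n\sqrt{2n+1}\int_{-\pi}^{\pi}\eta_h(t)\,e^{int}\,dt\quad(n\ge 0).$$ **Theorem.** Let $k>1$ be an integer, let $c>0$, let $f\in L^2(0,1)$ and let $g=Af$ on $[0,1]$. Assume that $g\in H^k_\mu(0,1)$ and that $$\lim_{t\to 0}\frac{d^j}{dt^j}\left[g\!\left(\sin^2\tfrac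 t2\right)\right]=0\qquad (j=0,1,\dots,k-1).$$ For $\varepsilon>0$ let $g^{(\varepsilon)}$ be noisy data with $\|g-g^{(\varepsilon)}\|_{L^2_\mu(0,1)}\le\varepsilon$, let the truncation index be $N=c\,\varepsilon^{-1/k}$ rounded to a nonnegative integer (that is, $N=N(\varepsilon)\in\mathbb{Z}_{\ge 0}$ is any integer with $|N-c\,\varepsilon^{-1/k}|\le 1$), and let $$f_N^{(\varepsilon)}(x)=\sum_{n=0}^{N}c_n\big(g^{(\varepsilon)}\big)\,\overline P_n(x).$$ Then $$\big\|f-f_N^{(\varepsilon)}\big\|_{L^2(0,1)}=O\!\left(\varepsilon^{(k-1)/k}\right)\qquad(\varepsilon\to 0^+),$$ uniformly in the noise and in the rounding: there are $C>0$ and $\varepsilon_0>0$, depending only on $k$, $c$ and $f$, such that $\|f-f_N^{(\varepsilon)}\|_{L^2(0,1)}\le C\,\varepsilon^{(k-1)/k}$ for all $0<\varepsilon\le\varepsilon_0$, all $g^{(\varepsilon)}$ and all $N$ as above. -/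

import Mathlib

open MeasureTheory Set Filter Topology

open scoped ContDiff

noncomputable section

namespace AbelInversion

/-- The Abel transform `(A f)(x) = ∫₀ˣ f(y) / √(x - y) dy`. -/
def abelTransform (f : ℝ → ℝ) (x : ℝ) : ℝ :=
  ∫ y in (0 : ℝ)..x, f y / √(x - y)

/-- Lebesgue measure on `E = (0, 1)`. -/
def volE : Measure ℝ := volume.restrict (Ioo 0 1)

/-- The measure `dμ(x) = dx / √(x (1 - x))` on `E = (0, 1)`. -/
def muE : Measure ℝ :=
  volE.withDensity fun x => ENNReal.ofReal (1 / √(x * (1 - x)))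

/-- `v` is the weak derivative of order `j` of `u` on `E = (0, 1)`. It is only used for
`u`, `v` in `L²_μ(E)`, hence integrable on `E`. -/
def IsWeakDeriv (j : ℕ) (u v : ℝ → ℝ) : Prop :=
  ∀ φ : ℝ → ℝ, ContDiff ℝ ∞ φ → HasCompactSupport φ → tsupport φ ⊆ Ioo 0 1 →
    ∫ x, u x * iteratedDeriv j φ x ∂volE = (-1) ^ j * ∫ x, v x * φ x ∂volE

/-- The weighted Sobolev space `H^k_μ(E)`: `u` is in `L²_μ(E)`, and for all `j ≤ k` the weak
derivative of order `j` exists and is in `L²_μ(E)`. -/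
def MemSobolevMu (k : ℕ) (u : ℝ → ℝ) : Prop :=
  MemLp u 2 muE ∧ ∀ j ≤ k, ∃ v : ℝ → ℝ, MemLp v 2 muE ∧ IsWeakDeriv j u v

/-- The ordinary Legendre polynomial `P_n(y) = ∑ₘ C(n,m) C(n+m,m) ((y - 1)/2)^m`; Mathlib's
`Polynomial.shiftedLegendre n` is `P_n(1 - 2 X)`. -/
def legendreP (n : ℕ) (y : ℝ) : ℝ :=
  Polynomial.aeval ((1 - y) / 2) (Polynomial.shiftedLegendre n)

/-- The orthonormal shifted Legendre polynomial `√(2n+1) P_n(2x - 1)`. -/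
def legendreBar (n : ℕ) (x : ℝ) : ℝ :=
  √(2 * n + 1) * legendreP n (2 * x - 1)

/-- The auxiliary function `η(t) = sgn(t) / (2πi) · e^{it/2} · g(sin²(t/2))`, for
`t` in `[-π, π)`, built from the data function `g`. -/
def eta (g : ℝ → ℝ) (t : ℝ) : ℂ :=
  (Real.sign t : ℂ) / (2 * Real.pi * Complex.I) * Complex.exp (Complex.I * t / 2)
    * (g (Real.sin (t / 2) ^ 2) : ℂ)

/-- The Fourier coefficient `γ̂_n = ∫_{-π}^{π} η(t) e^{int} dt`. -/
def gammaHat (g : ℝ → ℝ) (n : ℕ) : ℂ :=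
  ∫ t in (-Real.pi)..Real.pi, eta g t * Complex.exp (Complex.I * n * t)

/-- The Legendre coefficient `c_n = (-1)^n √(2n+1) γ̂_n` computed from the data `g`. -/
def legendreCoeff (g : ℝ → ℝ) (n : ℕ) : ℂ :=
  (-1) ^ n * (√(2 * n + 1) : ℂ) * gammaHat g n

/-- The truncated expansion `∑_{n=0}^{N} c_n P̄_n(x)`, the spectral cut-off
reconstruction from the data `g`. -/
def reconstruction (g : ℝ → ℝ) (N : ℕ) (x : ℝ) : ℂ :=
  ∑ n ∈ Finset.range (N + 1), legendreCoeff g n * (legendreBar n x : ℂ)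

end AbelInversion

end

noncomputable section

namespace AbelInversion

/-! The data coefficients are the exact Legendre coefficients of `f` when the data are exact. Under
`x = sin² (t/2)` the measure `μ` becomes Lebesgue measure on `(0, π)`, and `gammaHat` becomes the
half-integer sine coefficient `sineCoeff` (`gammaHat_eq_sineCoeff`). Substituting `g = A f`,
exchanging integrals and integrating the sine against two Abel kernels yields a Legendre polynomial,
which is the Mehler–Dirichlet formula (`integral_oddSinePoly_muE`, `sineCoeff_abelTransform`).

Since the normalized Legendre polynomials form a Hilbert basis, the squared error is a sum over
coefficients (`eLpNorm_sub_legendreSum_le`). Noise of size `ε` moves each sine coefficient by at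
most `ε` (`abs_sineCoeff_le`), so the indices `n ≤ N` contribute at most `∑ (2n+1) ε² = ((N+1) ε)²`.
The indices `n > N` contribute `∑ (2n+1) sₙ²`, where `sₙ` is the sine coefficient of `g`.
Integrating by parts `k` times gives `sₙ = O(n^{-k})` (`IsPrimitiveChain.sineCoeff_decay`): boundary
terms vanish at `0` by hypothesis, and at `π` by parity. The tail is thus `O(N^{-2(k-1)})`, and `N ≈
c ε^{-1/k}` balances the two parts.

The integrations by parts need a regular representative of `g`, whereas the vanishing hypothesis
concerns the values of `g` itself. Weak differentiability gives a chain of primitives agreeing with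
`g` almost everywhere (`exists_chain_of_memSobolevMu`). That `g` is an Abel transform at every
point, together with `A ∘ A = π ∫`, upgrades this to equality on all of `[0, 1]`
(`abelTransform_eq_primitive`). -/

/-- The Abel kernel `r ↦ 1 / √r`, which vanishes for `r ≤ 0`. -/
def invSqrt (r : ℝ) : ℝ := 1 / √r

lemma invSqrt_of_nonpos {r : ℝ} (hr : r ≤ 0) : invSqrt r = 0 := by
  simp [invSqrt, Real.sqrt_eq_zero_of_nonpos hr]

lemma invSqrt_nonneg (r : ℝ) : 0 ≤ invSqrt r := by
  unfold invSqrt; positivity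

lemma measurable_invSqrt : Measurable invSqrt := by
  unfold invSqrt; fun_prop

lemma invSqrt_mul {a b : ℝ} (ha : 0 ≤ a) : invSqrt (a * b) = invSqrt a * invSqrt b := by
  simp [invSqrt, Real.sqrt_mul ha]; ring

/-! ### The substitution `x = sin² (t/2)` and the two measures on `(0, 1)`. -/

/-- The substitution `t ↦ sin² (t / 2)`. -/
def halfSinSq (t : ℝ) : ℝ := Real.sin (t / 2) ^ 2

lemma halfSinSq_mem_Icc (t : ℝ) : halfSinSq t ∈ Icc (0 : ℝ) 1 :=
  ⟨sq_nonneg _, Real.sin_sq_le_one _⟩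

lemma contDiff_halfSinSq : ContDiff ℝ ∞ halfSinSq := by
  unfold halfSinSq; fun_prop

lemma continuous_halfSinSq : Continuous halfSinSq := contDiff_halfSinSq.continuous

lemma hasDerivAt_halfSinSq (t : ℝ) :
    HasDerivAt halfSinSq (Real.sin (t / 2) * Real.cos (t / 2)) t := by
  have := ((Real.hasDerivAt_sin (t / 2)).comp t ((hasDerivAt_id t).div_const 2)).pow 2
  convert! this using 1
  simp; ring

lemma one_sub_halfSinSq (t : ℝ) : 1 - halfSinSq t = Real.cos (t / 2) ^ 2 := by
  rw [halfSinSq, Real.cos_sq']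

lemma sin_half_pos {t : ℝ} (ht : t ∈ Ioo 0 Real.pi) : 0 < Real.sin (t / 2) :=
  Real.sin_pos_of_pos_of_lt_pi (by linarith [ht.1]) (by linarith [ht.2, Real.pi_pos])

lemma cos_half_pos {t : ℝ} (ht : t ∈ Ioo 0 Real.pi) : 0 < Real.cos (t / 2) :=
  Real.cos_pos_of_mem_Ioo ⟨by linarith [ht.1, Real.pi_pos], by linarith [ht.2]⟩

lemma strictMonoOn_halfSinSq : StrictMonoOn halfSinSq (Icc 0 Real.pi) := by
  intro a ha b hb hab
  have h1 : Real.sin (a / 2) < Real.sin (b / 2) :=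
    Real.strictMonoOn_sin ⟨by linarith [ha.1, Real.pi_pos], by linarith [ha.2]⟩
      ⟨by linarith [hb.1, Real.pi_pos], by linarith [hb.2]⟩ (by linarith)
  have h0 : 0 ≤ Real.sin (a / 2) :=
    Real.sin_nonneg_of_nonneg_of_le_pi (by linarith [ha.1]) (by linarith [ha.2, Real.pi_pos])
  exact pow_lt_pow_left₀ h1 h0 two_ne_zero

lemma halfSinSq_zero : halfSinSq 0 = 0 := by simp [halfSinSq]

lemma halfSinSq_pi : halfSinSq Real.pi = 1 := by simp [halfSinSq]

lemma halfSinSq_image_Ioo {t : ℝ} (ht : t ∈ Icc 0 Real.pi) :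
    halfSinSq '' Ioo 0 t = Ioo 0 (halfSinSq t) := by
  apply Subset.antisymm
  · rintro _ ⟨u, hu, rfl⟩
    have hu' : u ∈ Icc 0 Real.pi := ⟨hu.1.le, hu.2.le.trans ht.2⟩
    refine ⟨?_, strictMonoOn_halfSinSq hu' ht hu.2⟩
    have := strictMonoOn_halfSinSq ⟨le_rfl, Real.pi_pos.le⟩ hu' hu.1
    rwa [halfSinSq_zero] at this
  · have := intermediate_value_Ioo ht.1 (continuous_halfSinSq.continuousOn (s := Icc 0 t))
    rwa [halfSinSq_zero] at this

/-- The substitution `x = sin² (t / 2)` carries Lebesgue measure on `(0, π)` to `μ`. -/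
lemma measurePreserving_halfSinSq :
    MeasurePreserving halfSinSq (volume.restrict (Ioo 0 Real.pi)) muE := by
  refine ⟨continuous_halfSinSq.measurable, ?_⟩
  refine Measure.ext_of_lintegral _ fun F hF => ?_
  have hm : Measurable fun x : ℝ => ENNReal.ofReal (1 / √(x * (1 - x))) := by fun_prop
  rw [lintegral_map hF continuous_halfSinSq.measurable, muE,
    lintegral_withDensity_eq_lintegral_mul _ hm hF, volE]
  have him := halfSinSq_image_Ioo (t := Real.pi) ⟨Real.pi_pos.le, le_rfl⟩
  rw [halfSinSq_pi] at him
  rw [← him, lintegral_image_eq_lintegral_abs_deriv_mul measurableSet_Ioo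
    (fun x _ => (hasDerivAt_halfSinSq x).hasDerivWithinAt)
    (strictMonoOn_halfSinSq.injOn.mono Ioo_subset_Icc_self)]
  refine setLIntegral_congr_fun measurableSet_Ioo fun t ht => ?_
  have h1 := sin_half_pos ht
  have h2 := cos_half_pos ht
  simp only [Pi.mul_apply]
  -- The Jacobian `sin (t/2) cos (t/2)` is exactly `√(x (1 - x))`, so it cancels the weight.
  rw [← mul_assoc, one_sub_halfSinSq, halfSinSq, ← mul_pow, Real.sqrt_sq (by positivity),
    abs_of_pos (by positivity), ← ENNReal.ofReal_mul (by positivity), mul_one_div_cancel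
    (by positivity)]
  simp

instance : IsFiniteMeasure muE := by
  refine ⟨?_⟩
  rw [← measurePreserving_halfSinSq.measure_preimage MeasurableSet.univ.nullMeasurableSet]
  simp

instance : IsFiniteMeasure volE := by unfold volE; infer_instance

lemma muE_univ : muE univ = ENNReal.ofReal Real.pi := by
  rw [← measurePreserving_halfSinSq.measure_preimage MeasurableSet.univ.nullMeasurableSet]
  simp

lemma integral_muE_eq_volE (F : ℝ → ℝ) :
    ∫ x, F x ∂muE = ∫ x, invSqrt x * invSqrt (1 - x) * F x ∂volE := by
  have hm : Measurable fun x : ℝ => ENNReal.ofReal (1 / √(x * (1 - x))) := by fun_prop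
  rw [muE, integral_withDensity_eq_integral_toReal_smul hm (by simp)]
  refine setIntegral_congr_fun measurableSet_Ioo fun x hx => ?_
  simp only [smul_eq_mul]
  rw [ENNReal.toReal_ofReal (by positivity), ← invSqrt_mul hx.1.le, invSqrt]

lemma integral_muE_eq_trig {F : ℝ → ℝ} (hF : AEStronglyMeasurable F muE) :
    ∫ x, F x ∂muE = ∫ t in (0 : ℝ)..Real.pi, F (halfSinSq t) := by
  rw [intervalIntegral.integral_of_le Real.pi_pos.le, integral_Ioc_eq_integral_Ioo,
    ← measurePreserving_halfSinSq.map_eq] at *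
  exact integral_map continuous_halfSinSq.aemeasurable hF

lemma absolutelyContinuous_muE : muE ≪ volE := withDensity_absolutelyContinuous _ _

/-- The weight is at least `1` because `x (1 - x) ≤ 1`; hence `L²_μ` functions are Lebesgue
integrable on `(0, 1)`. -/
lemma volE_le_muE : volE ≤ muE := by
  refine Measure.le_iff.2 fun S hS => ?_
  rw [muE, withDensity_apply _ hS, volE, Measure.restrict_restrict hS]
  calc volume.restrict (Ioo 0 1) S = ∫⁻ _ in S ∩ Ioo 0 1, 1 := by
        simp [Measure.restrict_apply hS]
    _ ≤ _ := by
        refine setLIntegral_mono' (hS.inter measurableSet_Ioo) fun x hx => ?_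
        rw [ENNReal.one_le_ofReal, one_le_div (by
          have := hx.2.1; have := hx.2.2
          exact Real.sqrt_pos.2 (mul_pos hx.2.1 (by linarith)))]
        exact Real.sqrt_le_one.2 (by nlinarith [hx.2.1, hx.2.2])

lemma integral_volE_eq_volume {F : ℝ → ℝ} (hF : ∀ x, x ∉ Ioo (0 : ℝ) 1 → F x = 0) :
    ∫ x, F x ∂volE = ∫ x, F x :=
  setIntegral_eq_integral_of_forall_compl_eq_zero hF

/-! ### Products of Abel kernels, Fubini, and `A ∘ A`. -/

/-- The Abel transform on `[0, 1]` as an integral over all of `(0, 1)`. -/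
lemma abelTransform_eq (f : ℝ → ℝ) {x : ℝ} (hx : x ∈ Icc (0 : ℝ) 1) :
    abelTransform f x = ∫ y, f y * invSqrt (x - y) ∂volE := by
  rw [abelTransform, intervalIntegral.integral_of_le hx.1, volE, ← integral_Ioc_eq_integral_Ioo,
    setIntegral_eq_of_subset_of_forall_sdiff_eq_zero measurableSet_Ioc
      (Ioc_subset_Ioc_right hx.2)]
  · exact setIntegral_congr_fun measurableSet_Ioc fun y _ => by simp [invSqrt, div_eq_mul_inv]
  · intro y hy
    have : x < y := by
      by_contra h
      exact hy.2 ⟨hy.1.1, not_lt.1 h⟩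
    rw [invSqrt_of_nonpos (by linarith), mul_zero]

/-- The affine substitution `y = z + (x - z) r` in the product of two Abel kernels. -/
lemma integral_invSqrt_mul_invSqrt (p : ℝ → ℝ) {x z : ℝ} (hz : 0 ≤ z) (hzx : z < x) (hx : x ≤ 1) :
    ∫ y, p y * invSqrt (x - y) * invSqrt (y - z) ∂volE = ∫ r, p (z + (x - z) * r) ∂muE := by
  have hpos : 0 < x - z := by linarith
  rw [integral_muE_eq_volE, integral_volE_eq_volume, integral_volE_eq_volume]
  · have h1 : ∫ y, p y * invSqrt (x - y) * invSqrt (y - z) =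
        ∫ y, p (y + z) * invSqrt (x - (y + z)) * invSqrt (y + z - z) :=
      (integral_add_right_eq_self
        (fun y => p y * invSqrt (x - y) * invSqrt (y - z)) z).symm
    have h2 := Measure.integral_comp_mul_left
      (fun y => p (y + z) * invSqrt (x - (y + z)) * invSqrt (y + z - z)) (x - z)
    rw [h1, ← mul_right_inj' (inv_pos.2 hpos).ne']
    rw [abs_of_pos (inv_pos.2 hpos), smul_eq_mul] at h2
    rw [← h2, ← integral_const_mul]
    refine integral_congr_ae (Eventually.of_forall fun r => ?_)
    simp only
    rw [show x - ((x - z) * r + z) = (x - z) * (1 - r) by ring,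
      show (x - z) * r + z - z = (x - z) * r by ring, invSqrt_mul hpos.le, invSqrt_mul hpos.le,
      add_comm ((x - z) * r)]
    -- Each kernel releases a factor `(x - z)^{-1/2}`; together they cancel the Jacobian, leaving a
    -- weight independent of `x` and `z`.
    have h3 : invSqrt (x - z) * invSqrt (x - z) = (x - z)⁻¹ := by
      rw [invSqrt, one_div, ← mul_inv, Real.mul_self_sqrt hpos.le]
    linear_combination (p (z + (x - z) * r) * invSqrt (1 - r) * invSqrt r) * h3
  · intro r hr
    rcases not_and_or.1 hr with h | h
    · rw [invSqrt_of_nonpos (not_lt.1 h)]; ring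
    · rw [invSqrt_of_nonpos (r := 1 - r) (by linarith)]; ring
  · intro r hr
    rcases not_and_or.1 hr with h | h
    · rw [invSqrt_of_nonpos (r := r - z) (by linarith)]; ring
    · rw [invSqrt_of_nonpos (r := x - r) (by linarith)]; ring

lemma integral_invSqrt_mul_invSqrt_of_le (p : ℝ → ℝ) {x z : ℝ} (hzx : x ≤ z) :
    ∫ y, p y * invSqrt (x - y) * invSqrt (y - z) ∂volE = 0 := by
  have : ∀ y, p y * invSqrt (x - y) * invSqrt (y - z) = 0 := fun y => by
    rcases le_total x y with h | h
    · rw [invSqrt_of_nonpos (r := x - y) (by linarith)]; ring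
    · rw [invSqrt_of_nonpos (r := y - z) (by linarith)]; ring
  simp [this]

lemma integrable_invSqrt_mul_invSqrt {x z : ℝ} (hz : 0 ≤ z) (hx : x ≤ 1) :
    Integrable (fun y => invSqrt (x - y) * invSqrt (y - z)) volE := by
  rcases lt_or_ge z x with h | h
  -- A Bochner integral is `0` for non-integrable functions, so the value `π` already proves
  -- integrability.
  · refine Integrable.of_integral_ne_zero ?_
    have := integral_invSqrt_mul_invSqrt (fun _ => 1) hz h hx
    simp only [one_mul] at this
    rw [this]
    simp [measureReal_def, muE_univ, Real.pi_pos.le, Real.pi_ne_zero]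
  · have : ∀ y, invSqrt (x - y) * invSqrt (y - z) = 0 := fun y => by
      rcases le_total x y with h' | h'
      · rw [invSqrt_of_nonpos (r := x - y) (by linarith)]; ring
      · rw [invSqrt_of_nonpos (r := y - z) (by linarith)]; ring
    simp [this]

lemma norm_integral_invSqrt_le {x z : ℝ} (hz : 0 ≤ z) (hx : x ≤ 1) :
    ‖∫ y, invSqrt (x - y) * invSqrt (y - z) ∂volE‖ ≤ Real.pi := by
  rcases lt_or_ge z x with h | h
  · have := integral_invSqrt_mul_invSqrt (fun _ => 1) hz h hx
    simp only [one_mul] at this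
    rw [this]
    simp [measureReal_def, muE_univ, Real.pi_pos.le, abs_of_pos Real.pi_pos]
  · have := integral_invSqrt_mul_invSqrt_of_le (fun _ => 1) h
    simp only [one_mul] at this
    rw [this]
    simpa using Real.pi_pos.le

lemma ae_volE_mem : ∀ᵐ x ∂volE, x ∈ Ioo (0 : ℝ) 1 := ae_restrict_mem measurableSet_Ioo

/-- Integrability of the double Abel integrand. -/
lemma integrable_double_abel {f p : ℝ → ℝ} (hf : Integrable f volE) (hp : Continuous p)
    {x : ℝ} (hx : x ≤ 1) :
    Integrable (Function.uncurry fun y z => p y * invSqrt (x - y) * (f z * invSqrt (y - z)))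
      (volE.prod volE) := by
  have hmeas : AEStronglyMeasurable
      (Function.uncurry fun y z => p y * invSqrt (x - y) * (f z * invSqrt (y - z)))
      (volE.prod volE) := by
    have h1 : AEStronglyMeasurable (fun q : ℝ × ℝ => f q.2) (volE.prod volE) :=
      hf.1.comp_snd
    have h2 : Measurable fun q : ℝ × ℝ => p q.1 * invSqrt (x - q.1) :=
      (hp.measurable.comp measurable_fst).mul
        (measurable_invSqrt.comp (measurable_const.sub measurable_fst))
    have h3 : Measurable fun q : ℝ × ℝ => invSqrt (q.1 - q.2) :=
      measurable_invSqrt.comp (measurable_fst.sub measurable_snd)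
    exact h2.aestronglyMeasurable.mul (h1.mul h3.aestronglyMeasurable)
  obtain ⟨M, hM⟩ := isCompact_Icc.exists_bound_of_continuousOn (hp.continuousOn (s := Icc 0 1))
  have hM0 : 0 ≤ M := (norm_nonneg _).trans (hM 0 (by simp))
  rw [integrable_prod_iff' hmeas]
  have hsec : ∀ z : ℝ, 0 ≤ z → Integrable
      (fun y => p y * invSqrt (x - y) * (f z * invSqrt (y - z))) volE := fun z hz => by
    have := ((integrable_invSqrt_mul_invSqrt hz hx).const_mul (f z)).bdd_mul
      (f := p) (c := M) hp.aestronglyMeasurable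
      (by filter_upwards [ae_volE_mem] with y hy using hM y (Ioo_subset_Icc_self hy))
    refine this.congr (Eventually.of_forall fun y => ?_)
    simp only; ring
  constructor
  · filter_upwards [ae_volE_mem] with z hz using hsec z hz.1.le
  · refine Integrable.mono' (hf.norm.const_mul (M * Real.pi))
      hmeas.prod_swap.norm.integral_prod_right' ?_
    filter_upwards [ae_volE_mem] with z hz
    rw [Real.norm_of_nonneg (integral_nonneg fun _ => norm_nonneg _)]
    calc ∫ y, ‖p y * invSqrt (x - y) * (f z * invSqrt (y - z))‖ ∂volE
        ≤ ∫ y, M * ‖f z‖ * (invSqrt (x - y) * invSqrt (y - z)) ∂volE := by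
          refine integral_mono_ae (hsec z hz.1.le).norm
            ((integrable_invSqrt_mul_invSqrt hz.1.le hx).const_mul _) ?_
          filter_upwards [ae_volE_mem] with y hy
          have := hM y (Ioo_subset_Icc_self hy)
          rw [norm_mul, norm_mul, norm_mul, Real.norm_of_nonneg (invSqrt_nonneg _),
            Real.norm_of_nonneg (invSqrt_nonneg _)]
          have h0 : 0 ≤ ‖f z‖ * (invSqrt (x - y) * invSqrt (y - z)) :=
            mul_nonneg (norm_nonneg _) (mul_nonneg (invSqrt_nonneg _) (invSqrt_nonneg _))
          nlinarith [mul_le_mul_of_nonneg_right this h0]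
      _ = M * ‖f z‖ * ∫ y, invSqrt (x - y) * invSqrt (y - z) ∂volE := integral_const_mul _ _
      -- The kernel integral is at most `π` uniformly in `z`; this is what makes Tonelli work for
      -- merely integrable `f`.
      _ ≤ M * ‖f z‖ * Real.pi := by
          gcongr
          exact (le_abs_self _).trans (norm_integral_invSqrt_le hz.1.le hx)
      _ = M * Real.pi * ‖f z‖ := by ring

lemma ae_volE_abelTransform_eq (f : ℝ → ℝ) :
    abelTransform f =ᵐ[volE] fun y => ∫ z, f z * invSqrt (y - z) ∂volE := by
  filter_upwards [ae_volE_mem] with y hy using abelTransform_eq f (Ioo_subset_Icc_self hy)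

lemma integral_mul_abelTransform {f p : ℝ → ℝ} (hf : Integrable f volE) (hp : Continuous p)
    {x : ℝ} (hx : x ≤ 1) :
    ∫ y, p y * invSqrt (x - y) * abelTransform f y ∂volE =
      ∫ z, f z * ∫ y, p y * invSqrt (x - y) * invSqrt (y - z) ∂volE ∂volE := by
  have h1 : ∫ y, p y * invSqrt (x - y) * abelTransform f y ∂volE =
      ∫ y, ∫ z, p y * invSqrt (x - y) * (f z * invSqrt (y - z)) ∂volE ∂volE := by
    refine integral_congr_ae ?_
    filter_upwards [ae_volE_abelTransform_eq f] with y hy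
    rw [hy, ← integral_const_mul]
  rw [h1, integral_integral_swap (integrable_double_abel hf hp hx)]
  refine integral_congr_ae (Eventually.of_forall fun z => ?_)
  simp only
  rw [← integral_const_mul]
  refine integral_congr_ae (Eventually.of_forall fun y => ?_)
  simp only; ring

/-- `∫₀ˣ p(y) (A f)(y) / √(x - y) dy` as a single integral of `f`. -/
lemma integral_mul_abelTransform_eq {f p : ℝ → ℝ} (hf : Integrable f volE) (hp : Continuous p)
    {x : ℝ} (hx : x ∈ Icc (0 : ℝ) 1) :
    ∫ y, p y * invSqrt (x - y) * abelTransform f y ∂volE =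
      ∫ z in (0 : ℝ)..x, f z * ∫ r, p (z + (x - z) * r) ∂muE := by
  rw [integral_mul_abelTransform hf hp hx.2, intervalIntegral.integral_of_le hx.1,
    integral_Ioc_eq_integral_Ioo, volE,
    setIntegral_eq_of_subset_of_forall_sdiff_eq_zero measurableSet_Ioo
      (Ioo_subset_Ioo_right hx.2)]
  · refine setIntegral_congr_fun measurableSet_Ioo fun z hz => ?_
    rw [← integral_invSqrt_mul_invSqrt p hz.1.le hz.2 hx.2, volE]
  · intro z hz
    have : x ≤ z := by
      by_contra h
      exact hz.2 ⟨hz.1.1, not_le.1 h⟩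
    have h0 := integral_invSqrt_mul_invSqrt_of_le p this
    rw [volE] at h0
    rw [h0, mul_zero]

lemma integrable_abelTransform {f : ℝ → ℝ} (hf : Integrable f volE) :
    Integrable (abelTransform f) volE := by
  -- At `x = 1` the marginal is `A f (y) / √(1 - y)`; multiplying by the bounded function `√(1 - y)`
  -- removes the extra weight.
  have h := (integrable_double_abel hf continuous_const (p := fun _ => (1 : ℝ)) le_rfl).integral_prod_left
  have h2 : AEStronglyMeasurable (fun y => √(1 - y)) volE := by fun_prop
  have h3 := h.bdd_mul (f := fun y => √(1 - y)) (c := 1) h2 (by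
    filter_upwards [ae_volE_mem] with y hy
    rw [Real.norm_of_nonneg (Real.sqrt_nonneg _)]
    exact Real.sqrt_le_one.2 (by linarith [hy.1]))
  refine h3.congr ?_
  filter_upwards [ae_volE_mem, ae_volE_abelTransform_eq f] with y hy hA
  rw [hA]
  simp only [Function.uncurry, one_mul, integral_const_mul]
  rw [← mul_assoc, invSqrt, mul_one_div_cancel (Real.sqrt_pos.2 (by linarith [hy.2])).ne', one_mul]

/-- `A ∘ A` is `π` times integration. -/
lemma abelTransform_abelTransform {f : ℝ → ℝ} (hf : Integrable f volE) {x : ℝ}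
    (hx : x ∈ Icc (0 : ℝ) 1) :
    abelTransform (abelTransform f) x = Real.pi * ∫ z in (0 : ℝ)..x, f z := by
  have h := integral_mul_abelTransform_eq hf (p := fun _ => 1) continuous_const hx
  rw [abelTransform_eq _ hx]
  have h2 : ∫ r, (1 : ℝ) ∂muE = Real.pi := by
    simp [measureReal_def, muE_univ, Real.pi_pos.le]
  rw [h2, intervalIntegral.integral_mul_const] at h
  rw [mul_comm, ← h]
  refine integral_congr_ae (Eventually.of_forall fun y => ?_)
  simp only; ring

lemma abelTransform_congr {f f' : ℝ → ℝ} (h : f =ᵐ[volE] f') {x : ℝ}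
    (hx : x ∈ Icc (0 : ℝ) 1) : abelTransform f x = abelTransform f' x := by
  rw [abelTransform_eq _ hx, abelTransform_eq _ hx]
  exact integral_congr_ae (h.mono fun y hy => by simp only [hy])

/-! ### Half-integer sines and the Mehler–Dirichlet formula. -/

/-- The polynomial `q` with `sin ((2n+1) u) = (-1)ⁿ sin u · q (-4 cos² u)`. -/
def oddSinePoly (n : ℕ) (z : ℝ) : ℝ :=
  ∑ m ∈ Finset.range (n + 1), ((n + m).choose (2 * m) : ℝ) * z ^ m

/-- The polynomial `q` with `sin ((2n+2) u) = (-1)ⁿ 2 sin u cos u · q (-4 cos² u)`. -/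
def evenSinePoly (n : ℕ) (z : ℝ) : ℝ :=
  ∑ m ∈ Finset.range (n + 1), ((n + m + 1).choose (2 * m + 1) : ℝ) * z ^ m

/-- Pascal's rule on coefficients. With `evenSinePoly_succ` it mirrors `sin (a + 2u) = 2 sin (a + u)
cos u - sin a` at `z = -4 cos² u`. -/
lemma oddSinePoly_succ (n : ℕ) (z : ℝ) :
    oddSinePoly (n + 1) z = oddSinePoly n z + z * evenSinePoly n z := by
  have h1 : oddSinePoly n z =
      ∑ m ∈ Finset.range (n + 2), ((n + m).choose (2 * m) : ℝ) * z ^ m := by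
    rw [Finset.sum_range_succ, Nat.choose_eq_zero_of_lt (by lia)]
    simp [oddSinePoly]
  rw [h1, oddSinePoly, evenSinePoly, Finset.sum_range_succ', Finset.sum_range_succ' _ (n + 1),
    Finset.mul_sum]
  simp only [add_zero]
  rw [add_right_comm, ← Finset.sum_add_distrib]
  refine congrArg₂ _ (Finset.sum_congr rfl fun m _ => ?_) (by simp)
  rw [show n + 1 + (m + 1) = (n + m + 1) + 1 by ring, show 2 * (m + 1) = (2 * m + 1) + 1 by ring,
    Nat.choose_succ_succ, show n + (m + 1) = n + m + 1 by ring]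
  push_cast
  ring

lemma evenSinePoly_succ (n : ℕ) (z : ℝ) :
    evenSinePoly (n + 1) z = oddSinePoly (n + 1) z + evenSinePoly n z := by
  have h1 : evenSinePoly n z =
      ∑ m ∈ Finset.range (n + 2), ((n + m + 1).choose (2 * m + 1) : ℝ) * z ^ m := by
    rw [Finset.sum_range_succ, Nat.choose_eq_zero_of_lt (by lia)]
    simp [evenSinePoly]
  rw [h1, oddSinePoly, evenSinePoly, ← Finset.sum_add_distrib]
  refine Finset.sum_congr rfl fun m _ => ?_
  rw [show n + 1 + m + 1 = (n + m + 1) + 1 by ring, Nat.choose_succ_succ,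
    show n + 1 + m = n + m + 1 by ring]
  push_cast
  ring

lemma sin_multiples (u : ℝ) (n : ℕ) :
    Real.sin ((2 * n + 1) * u) =
        (-1) ^ n * Real.sin u * oddSinePoly n (-4 * Real.cos u ^ 2) ∧
      Real.sin ((2 * n + 2) * u) =
        (-1) ^ n * (2 * Real.sin u * Real.cos u) * evenSinePoly n (-4 * Real.cos u ^ 2) := by
  have key : ∀ a : ℝ, Real.sin (a + 2 * u) = 2 * Real.sin (a + u) * Real.cos u - Real.sin a := by
    intro a
    have h1 : Real.sin (a + 2 * u) = Real.sin ((a + u) + u) := by ring_nf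
    have h2 : Real.sin a = Real.sin ((a + u) - u) := by ring_nf
    rw [h1, h2, Real.sin_add, Real.sin_sub]; ring
  induction n with
  | zero => simp [oddSinePoly, evenSinePoly, Real.sin_two_mul]
  | succ n ih =>
    obtain ⟨h1, h2⟩ := ih
    have h3 : Real.sin ((2 * (n + 1 : ℕ) + 1) * u) =
        (-1) ^ (n + 1) * Real.sin u * oddSinePoly (n + 1) (-4 * Real.cos u ^ 2) := by
      have := key ((2 * n + 1) * u)
      rw [show (2 * (n : ℝ) + 1) * u + 2 * u = (2 * (n + 1 : ℕ) + 1) * u by push_cast; ring,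
        show (2 * (n : ℝ) + 1) * u + u = (2 * n + 2) * u by ring, h1, h2] at this
      rw [this, oddSinePoly_succ, pow_succ]; ring
    refine ⟨h3, ?_⟩
    have := key ((2 * n + 2) * u)
    rw [show (2 * (n : ℝ) + 2) * u + 2 * u = (2 * (n + 1 : ℕ) + 2) * u by push_cast; ring,
      show (2 * (n : ℝ) + 2) * u + u = (2 * (n + 1 : ℕ) + 1) * u by push_cast; ring, h3, h2] at this
    rw [this, evenSinePoly_succ, pow_succ]; ring

lemma prod_odd_div_even (m : ℕ) :
    ∏ i ∈ Finset.range m, (2 * (i : ℝ) + 1) / (2 * i + 2) = (m.centralBinom : ℝ) / 4 ^ m := by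
  induction m with
  | zero => simp
  | succ m ih =>
    rw [Finset.prod_range_succ, ih]
    have h := Nat.succ_mul_centralBinom_succ m
    have h' : ((m : ℝ) + 1) * ((m + 1).centralBinom : ℝ) = 2 * (2 * m + 1) * m.centralBinom := by
      exact_mod_cast h
    have hm : (m : ℝ) + 1 ≠ 0 := by positivity
    rw [pow_succ]
    field_simp
    linear_combination (-2) * h'

/-- In the variable `t` these moments are Wallis integrals of `cos (t/2) ^ (2m)`. -/
lemma integral_one_sub_pow_muE (m : ℕ) :
    ∫ r, (1 - r) ^ m ∂muE = Real.pi * ((2 * m).choose m : ℝ) / 4 ^ m := by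
  rw [integral_muE_eq_trig (by fun_prop)]
  have h1 : ∀ t, (1 - halfSinSq t) ^ m = Real.cos (t / 2) ^ (2 * m) := fun t => by
    rw [one_sub_halfSinSq, ← pow_mul]
  simp only [h1]
  rw [intervalIntegral.integral_comp_div (fun t => Real.cos t ^ (2 * m)) two_ne_zero, zero_div,
    EulerSine.integral_cos_pow_eq, integral_sin_pow_even, prod_odd_div_even, Nat.centralBinom]
  simp; ring

lemma legendreP_two_mul_sub_one (n : ℕ) (z : ℝ) :
    legendreP n (2 * z - 1) = ∑ m ∈ Finset.range (n + 1),
      (-1) ^ m * (n.choose m : ℝ) * ((n + m).choose n : ℝ) * (1 - z) ^ m := by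
  rw [legendreP, show (1 - (2 * z - 1)) / 2 = 1 - z by ring, Polynomial.shiftedLegendre]
  simp

/-- The half-integer sine coefficient of the data in the variable `t`, `x = sin² (t / 2)`. -/
def sineCoeff (h : ℝ → ℝ) (n : ℕ) : ℝ :=
  (1 / Real.pi) * ∫ t in (0 : ℝ)..Real.pi, Real.sin ((n + 1 / 2) * t) * h (halfSinSq t)

lemma sin_half_integer (n : ℕ) {t : ℝ} (ht : t ∈ Icc 0 Real.pi) :
    Real.sin ((n + 1 / 2) * t) =
      √(halfSinSq t) * ((-1) ^ n * oddSinePoly n (-4 * (1 - halfSinSq t))) := by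
  have := (sin_multiples (t / 2) n).1
  rw [show ((n : ℝ) + 1 / 2) * t = (2 * n + 1) * (t / 2) by ring, this, one_sub_halfSinSq,
    halfSinSq, Real.sqrt_sq (Real.sin_nonneg_of_nonneg_of_le_pi (by linarith [ht.1])
      (by linarith [ht.2, Real.pi_pos]))]
  ring

/-- Trinomial revision: a sine-polynomial coefficient times the central binomial from the moments is
a Legendre coefficient. -/
lemma choose_mul_central (n m : ℕ) :
    (n + m).choose (2 * m) * (2 * m).choose m = n.choose m * (n + m).choose n := by
  have h := Nat.choose_mul (n := n + m) (k := 2 * m) (s := m) (by lia)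
  rw [h, show n + m - m = n by lia, show 2 * m - m = m by lia, Nat.add_comm n m,
    Nat.choose_symm_add, mul_comm]

lemma continuous_oddSinePoly (n : ℕ) : Continuous (oddSinePoly n) := by
  unfold oddSinePoly; fun_prop

lemma continuous_legendreP (n : ℕ) : Continuous fun z : ℝ => legendreP n (2 * z - 1) := by
  simp only [legendreP_two_mul_sub_one]; fun_prop

/-- Since `1 - (z + (1 - z) r) = (1 - z)(1 - r)`, the integral is computed term by term from the
moments of `1 - r`, whose `4^{-m}` cancels the `4^m` of the argument. -/
lemma integral_oddSinePoly_muE (n : ℕ) (z : ℝ) :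
    ∫ r, oddSinePoly n (-4 * (1 - (z + (1 - z) * r))) ∂muE =
      Real.pi * legendreP n (2 * z - 1) := by
  have hint : ∀ m : ℕ, Integrable (fun r : ℝ => (1 - r) ^ m) muE := fun m => by
    refine Integrable.of_integral_ne_zero ?_
    rw [integral_one_sub_pow_muE]
    have : 0 < (2 * m).choose m := Nat.choose_pos (by lia)
    have := Real.pi_pos
    positivity
  have h1 : ∀ r : ℝ, oddSinePoly n (-4 * (1 - (z + (1 - z) * r))) =
      ∑ m ∈ Finset.range (n + 1),
        (((n + m).choose (2 * m) : ℝ) * (-4 * (1 - z)) ^ m) * (1 - r) ^ m := fun r => by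
    refine Finset.sum_congr rfl fun m _ => ?_
    rw [show -4 * (1 - (z + (1 - z) * r)) = (-4 * (1 - z)) * (1 - r) by ring, mul_pow]; ring
  simp only [h1]
  rw [integral_finsetSum _ fun m _ => (hint m).const_mul _, legendreP_two_mul_sub_one,
    Finset.mul_sum]
  refine Finset.sum_congr rfl fun m _ => ?_
  rw [integral_const_mul, integral_one_sub_pow_muE]
  have := choose_mul_central n m
  have h2 : ((n + m).choose (2 * m) : ℝ) * (2 * m).choose m = n.choose m * (n + m).choose n := by
    exact_mod_cast this
  have h4 : (-4 : ℝ) ^ m / 4 ^ m = (-1) ^ m := by rw [← div_pow]; norm_num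
  rw [mul_pow, ← h4]
  linear_combination (Real.pi * ((-4) ^ m / 4 ^ m) * (1 - z) ^ m) * h2

/-- The half-integer sine coefficients of the Abel transform of `f` are Legendre coefficients
of `f`. -/
lemma sineCoeff_abelTransform {f g : ℝ → ℝ} (hf : Integrable f volE)
    (hfg : ∀ x ∈ Icc (0 : ℝ) 1, g x = abelTransform f x) (n : ℕ) :
    sineCoeff g n = (-1) ^ n * ∫ z, f z * legendreP n (2 * z - 1) ∂volE := by
  set q : ℝ → ℝ := fun x => (-1) ^ n * oddSinePoly n (-4 * (1 - x)) with hq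
  have hqc : Continuous q := by
    have := continuous_oddSinePoly n
    fun_prop
  have h1 : ∫ t in (0 : ℝ)..Real.pi, Real.sin ((n + 1 / 2) * t) * g (halfSinSq t) =
      ∫ t in (0 : ℝ)..Real.pi, (fun x => √x * q x * abelTransform f x) (halfSinSq t) := by
    refine intervalIntegral.integral_congr fun t ht => ?_
    rw [uIcc_of_le Real.pi_pos.le] at ht
    simp only
    rw [hfg _ (halfSinSq_mem_Icc t), sin_half_integer n ht]
  have hmeas : AEStronglyMeasurable (fun x => √x * q x * abelTransform f x) muE :=
    ((Real.continuous_sqrt.mul hqc).aestronglyMeasurable).mul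
      ((integrable_abelTransform hf).1.mono_ac absolutelyContinuous_muE)
  rw [sineCoeff, h1, ← integral_muE_eq_trig hmeas, integral_muE_eq_volE]
  have h2 : ∫ x, invSqrt x * invSqrt (1 - x) * (√x * q x * abelTransform f x) ∂volE =
      ∫ x, q x * invSqrt (1 - x) * abelTransform f x ∂volE := by
    refine integral_congr_ae ?_
    filter_upwards [ae_volE_mem] with x hx
    -- The `√x` in the half-integer sine removes one half of the weight of `μ`; what remains is the
    -- Abel kernel at the endpoint `1`.
    have : invSqrt x * √x = 1 := one_div_mul_cancel (Real.sqrt_pos.2 hx.1).ne'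
    linear_combination (q x * invSqrt (1 - x) * abelTransform f x) * this
  rw [h2, integral_mul_abelTransform_eq hf hqc ⟨zero_le_one, le_rfl⟩]
  have h3 : ∀ z : ℝ, ∫ r, q (z + (1 - z) * r) ∂muE =
      Real.pi * ((-1) ^ n * legendreP n (2 * z - 1)) := fun z => by
    simp only [hq]
    rw [integral_const_mul, integral_oddSinePoly_muE]; ring
  simp only [h3]
  rw [intervalIntegral.integral_of_le zero_le_one, integral_Ioc_eq_integral_Ioo, ← volE,
    ← integral_const_mul, ← integral_const_mul]
  refine integral_congr_ae (Eventually.of_forall fun z => ?_)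
  have := Real.pi_ne_zero
  simp only
  field_simp

/-! ### Legendre polynomials: orthogonality, completeness, Parseval. -/

open Polynomial in
/-- The shifted Legendre polynomial with real coefficients. -/
def realLegendre (n : ℕ) : Polynomial ℝ := (shiftedLegendre n).map (Int.castRingHom ℝ)

lemma legendreP_eq_eval (n : ℕ) (x : ℝ) :
    legendreP n (2 * x - 1) = (-1) ^ n * (realLegendre n).eval x := by
  rw [legendreP, show (1 - (2 * x - 1)) / 2 = 1 - x by ring,
    Polynomial.shiftedLegendre_eval_symm, sub_sub_cancel, realLegendre, Polynomial.eval_map,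
    Polynomial.aeval_def]
  rfl

lemma integral_pow_mul_one_sub_pow (a b : ℕ) :
    ∫ x in (0 : ℝ)..1, x ^ a * (1 - x) ^ b =
      (a.factorial * b.factorial : ℝ) / (a + b + 1).factorial := by
  induction b generalizing a with
  | zero =>
    simp only [pow_zero, mul_one, integral_pow, add_zero, Nat.factorial_succ, Nat.factorial_zero]
    have := Nat.factorial_ne_zero a
    push_cast
    field_simp
    simp
  | succ b ih =>
    have h1 : ∀ x ∈ uIcc (0 : ℝ) 1, HasDerivAt (fun x : ℝ => (1 - x) ^ (b + 1))
        (-((b + 1 : ℝ) * (1 - x) ^ b)) x := fun x _ => by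
      have := ((hasDerivAt_id x).const_sub 1).pow (b + 1)
      convert! this using 1
      simp
    have h2 : ∀ x ∈ uIcc (0 : ℝ) 1, HasDerivAt (fun x : ℝ => x ^ (a + 1) / (a + 1))
        (x ^ a) x := fun x _ => by
      have := (hasDerivAt_pow (a + 1) x).div_const ((a : ℝ) + 1)
      convert! this using 1
      simp
      field_simp
    have h := intervalIntegral.integral_mul_deriv_eq_deriv_mul h1 h2
      (Continuous.intervalIntegrable (by fun_prop) _ _)
      (Continuous.intervalIntegrable (by fun_prop) _ _)
    have h3 : ∫ x in (0 : ℝ)..1, x ^ a * (1 - x) ^ (b + 1) =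
        ∫ x in (0 : ℝ)..1, (1 - x) ^ (b + 1) * x ^ a := by simp only [mul_comm]
    have h4 : ∫ x in (0 : ℝ)..1, -((b + 1 : ℝ) * (1 - x) ^ b) * (x ^ (a + 1) / (a + 1)) =
        -((b + 1) / (a + 1)) * ∫ x in (0 : ℝ)..1, x ^ (a + 1) * (1 - x) ^ b := by
      rw [← intervalIntegral.integral_const_mul]
      refine intervalIntegral.integral_congr fun x _ => ?_
      field_simp
    rw [h3, h, h4, ih, show a + 1 + b + 1 = a + (b + 1) + 1 by ring, Nat.factorial_succ a,
      Nat.factorial_succ b]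
    push_cast
    simp
    field_simp

lemma integral_mul_iterate_derivative (n : ℕ) (p q : Polynomial ℝ)
    (h0 : ∀ j < n, (Polynomial.derivative^[j] q).eval 0 = 0)
    (h1 : ∀ j < n, (Polynomial.derivative^[j] q).eval 1 = 0) :
    ∫ x in (0 : ℝ)..1, p.eval x * (Polynomial.derivative^[n] q).eval x =
      (-1) ^ n * ∫ x in (0 : ℝ)..1, (Polynomial.derivative^[n] p).eval x * q.eval x := by
  induction n generalizing p with
  | zero => simp
  | succ n ih =>
    have h := intervalIntegral.integral_mul_deriv_eq_deriv_mul (a := 0) (b := 1)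
      (fun x _ => p.hasDerivAt x)
      (fun x _ => (Polynomial.derivative^[n] q).hasDerivAt x)
      (Continuous.intervalIntegrable (by fun_prop) _ _)
      (Continuous.intervalIntegrable (by fun_prop) _ _)
    rw [Function.iterate_succ_apply', h, h0 n (by lia), h1 n (by lia),
      ih _ (fun j hj => h0 j (by lia)) (fun j hj => h1 j (by lia)),
      Function.iterate_succ_apply, pow_succ]
    ring

lemma factorial_mul_realLegendre (n : ℕ) : (n.factorial : Polynomial ℝ) * realLegendre n =
    Polynomial.derivative^[n] (Polynomial.X ^ n * (1 - Polynomial.X) ^ n) := by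
  have h := congrArg (Polynomial.map (Int.castRingHom ℝ))
    (Polynomial.factorial_mul_shiftedLegendre_eq n)
  rw [← Polynomial.iterate_derivative_map] at h
  simpa [realLegendre] using h

lemma eval_iterate_derivative_eq_zero {q r : Polynomial ℝ} {n j : ℕ} (hj : j < n) {a : ℝ}
    (hr : r.eval a = 0) (h : r ^ n ∣ q) : (Polynomial.derivative^[j] q).eval a = 0 := by
  obtain ⟨s, hs⟩ := Polynomial.pow_sub_dvd_iterate_derivative_of_pow_dvd j h
  rw [hs, Polynomial.eval_mul, Polynomial.eval_pow, hr, zero_pow (by lia), zero_mul]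

/-- Rodrigues' formula and `n` integrations by parts; `x = 0` and `x = 1` are zeros of order `n` of
`(x (1 - x))^n`, so no boundary terms arise. It yields both orthogonality and the norm. -/
lemma integral_mul_realLegendre (n : ℕ) (p : Polynomial ℝ) :
    (n.factorial : ℝ) * ∫ x in (0 : ℝ)..1, p.eval x * (realLegendre n).eval x =
      (-1) ^ n * ∫ x in (0 : ℝ)..1,
        (Polynomial.derivative^[n] p).eval x * (x ^ n * (1 - x) ^ n) := by
  have h := integral_mul_iterate_derivative n p (Polynomial.X ^ n * (1 - Polynomial.X) ^ n)
    (fun j hj => eval_iterate_derivative_eq_zero hj (r := Polynomial.X) (by simp)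
      (Dvd.intro _ rfl))
    (fun j hj => eval_iterate_derivative_eq_zero hj (r := 1 - Polynomial.X) (by simp)
      (Dvd.intro_left _ rfl))
  rw [← factorial_mul_realLegendre] at h
  simp only [Polynomial.eval_mul, Polynomial.eval_natCast, Polynomial.eval_pow, Polynomial.eval_X,
    Polynomial.eval_sub, Polynomial.eval_one] at h
  rw [← h, ← intervalIntegral.integral_const_mul]
  refine intervalIntegral.integral_congr fun x _ => ?_
  ring

lemma natDegree_realLegendre (n : ℕ) : (realLegendre n).natDegree = n := by
  rw [realLegendre, Polynomial.natDegree_map_eq_of_injective Int.cast_injective,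
    Polynomial.natDegree_shiftedLegendre]

lemma coeff_realLegendre_self (n : ℕ) :
    (realLegendre n).coeff n = (-1) ^ n * ((n + n).choose n : ℝ) := by
  rw [realLegendre, Polynomial.coeff_map, Polynomial.coeff_shiftedLegendre]
  simp

lemma integral_realLegendre_of_lt {m n : ℕ} (hmn : m < n) :
    ∫ x in (0 : ℝ)..1, (realLegendre m).eval x * (realLegendre n).eval x = 0 := by
  have h := integral_mul_realLegendre n (realLegendre m)
  rw [Polynomial.iterate_derivative_eq_zero (by rwa [natDegree_realLegendre])] at h
  have := Nat.factorial_ne_zero n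
  simpa [this] using h

lemma integral_realLegendre_sq (n : ℕ) :
    ∫ x in (0 : ℝ)..1, (realLegendre n).eval x * (realLegendre n).eval x = 1 / (2 * n + 1) := by
  have h := integral_mul_realLegendre n (realLegendre n)
  have hD : Polynomial.derivative^[n] (realLegendre n) =
      Polynomial.C ((n.factorial : ℝ) * ((-1) ^ n * ((n + n).choose n : ℝ))) := by
    have h1 : (Polynomial.derivative^[n] (realLegendre n)).natDegree ≤ 0 :=
      (Polynomial.natDegree_iterate_derivative _ _).trans (by rw [natDegree_realLegendre]; simp)
    rw [Polynomial.eq_C_of_natDegree_le_zero h1, Polynomial.coeff_iterate_derivative, zero_add,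
      coeff_realLegendre_self, Nat.descFactorial_self, nsmul_eq_mul]
  rw [hD] at h
  simp only [Polynomial.eval_C] at h
  rw [intervalIntegral.integral_const_mul, integral_pow_mul_one_sub_pow] at h
  have hf : (n.factorial : ℝ) ≠ 0 := by exact_mod_cast Nat.factorial_ne_zero n
  have hc : ((n + n).choose n : ℝ) * n.factorial * n.factorial = (n + n).factorial := by
    exact_mod_cast Nat.add_choose_mul_factorial_mul_factorial n n
  have hs : ((-1 : ℝ) ^ n) * (-1) ^ n = 1 := by rw [← mul_pow]; simp
  have hF : (((n + n + 1).factorial : ℕ) : ℝ) = (2 * n + 1) * (n + n).factorial := by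
    rw [Nat.factorial_succ]; push_cast; ring
  have hF0 : ((n + n).factorial : ℝ) ≠ 0 := by exact_mod_cast Nat.factorial_ne_zero _
  rw [hF] at h
  apply mul_left_cancel₀ hf
  rw [h]
  field_simp
  linear_combination ((n + n).choose n * n.factorial * n.factorial : ℝ) * hs + hc

lemma continuous_legendreBar (n : ℕ) : Continuous (legendreBar n) :=
  continuous_const.mul (continuous_legendreP n)

lemma memLp_volE_of_continuous {F : ℝ → ℝ} (hF : Continuous F) : MemLp F 2 volE := by
  obtain ⟨M, hM⟩ := isCompact_Icc.exists_bound_of_continuousOn (hF.continuousOn (s := Icc 0 1))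
  refine MemLp.of_bound hF.aestronglyMeasurable M ?_
  filter_upwards [ae_volE_mem] with y hy using hM y (Ioo_subset_Icc_self hy)

lemma integral_volE_eq_interval (F : ℝ → ℝ) : ∫ x, F x ∂volE = ∫ x in (0 : ℝ)..1, F x := by
  rw [intervalIntegral.integral_of_le zero_le_one, integral_Ioc_eq_integral_Ioo, volE]

lemma integral_legendreBar (m n : ℕ) :
    ∫ x, legendreBar m x * legendreBar n x ∂volE = if m = n then 1 else 0 := by
  have h1 : ∫ x, legendreBar m x * legendreBar n x ∂volE = √(2 * m + 1) * √(2 * n + 1) *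
      ((-1) ^ m * (-1) ^ n) *
        ∫ x in (0 : ℝ)..1, (realLegendre m).eval x * (realLegendre n).eval x := by
    rw [integral_volE_eq_interval, ← intervalIntegral.integral_const_mul]
    refine intervalIntegral.integral_congr fun x _ => ?_
    simp only [legendreBar, legendreP_eq_eval]
    ring
  rw [h1]
  split_ifs with h
  · subst h
    rw [integral_realLegendre_sq, Real.mul_self_sqrt (by positivity), ← mul_pow]
    have : (2 * (m : ℝ) + 1) ≠ 0 := by positivity
    simp
    field_simp
  · rcases lt_or_gt_of_ne h with h | h
    · rw [integral_realLegendre_of_lt h, mul_zero]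
    · simp_rw [mul_comm (Polynomial.eval _ (realLegendre m))]
      rw [integral_realLegendre_of_lt h, mul_zero]

/-- The shifted Legendre functions as elements of `L²(0, 1)`. -/
def legendreLp (n : ℕ) : Lp ℝ 2 volE :=
  (memLp_volE_of_continuous (continuous_legendreBar n)).toLp _

lemma inner_toLp {F : ℝ → ℝ} (hF : MemLp F 2 volE) (h : Lp ℝ 2 volE) :
    inner ℝ (hF.toLp F) h = ∫ x, F x * h x ∂volE := by
  rw [L2.inner_def]
  refine integral_congr_ae ?_
  filter_upwards [hF.coeFn_toLp] with x hx
  rw [hx]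
  simp [mul_comm]

lemma orthonormal_legendreLp : Orthonormal ℝ legendreLp := by
  rw [orthonormal_iff_ite]
  intro m n
  rw [legendreLp, inner_toLp, ← integral_legendreBar]
  refine integral_congr_ae ?_
  filter_upwards [(memLp_volE_of_continuous (continuous_legendreBar n)).coeFn_toLp] with x hx
  rw [legendreLp, hx]

lemma integrable_continuous_mul {F h : ℝ → ℝ} (hF : Continuous F) (hh : MemLp h 2 volE) :
    Integrable (fun x => F x * h x) volE :=
  (memLp_volE_of_continuous hF).integrable_mul hh

/-- One polynomial in each degree spans all polynomials, so orthogonality to the Legendre family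
extends by linearity. -/
lemma integral_polynomial_mul_eq_zero {h : ℝ → ℝ} (hh : MemLp h 2 volE)
    (h0 : ∀ n, ∫ x, legendreBar n x * h x ∂volE = 0) (p : Polynomial ℝ) :
    ∫ x, p.eval x * h x ∂volE = 0 := by
  let S : Polynomial.Sequence ℝ := ⟨realLegendre, fun i => by
    rw [realLegendre, Polynomial.degree_map_eq_of_injective Int.cast_injective,
      Polynomial.degree_shiftedLegendre]⟩
  have hspan : p ∈ Submodule.span ℝ (Set.range S) := by
    rw [Polynomial.Sequence.span S fun i => ?_]
    · trivial
    · exact (Polynomial.leadingCoeff_ne_zero.2 (S.ne_zero i)).isUnit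
  induction hspan using Submodule.span_induction with
  | mem q hq =>
    obtain ⟨n, rfl⟩ := hq
    have hn := h0 n
    have h1 : ∀ x, legendreBar n x * h x =
        (√(2 * n + 1) * (-1) ^ n) * ((realLegendre n).eval x * h x) := fun x => by
      rw [legendreBar, legendreP_eq_eval]; ring
    simp only [h1] at hn
    rw [integral_const_mul] at hn
    refine (mul_eq_zero.1 hn).resolve_left ?_
    have : √(2 * (n : ℝ) + 1) ≠ 0 := by positivity
    simp [this]
  | zero => simp
  | add q r _ _ hq hr =>
    simp only [Polynomial.eval_add, add_mul]
    rw [integral_add (integrable_continuous_mul q.continuous hh)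
      (integrable_continuous_mul r.continuous hh), hq, hr, add_zero]
  | smul c q _ hq =>
    simp only [Polynomial.eval_smul, smul_eq_mul, mul_assoc]
    rw [integral_const_mul, hq, mul_zero]

lemma integral_continuous_mul_eq_zero {h : ℝ → ℝ} (hh : MemLp h 2 volE)
    (h0 : ∀ n, ∫ x, legendreBar n x * h x ∂volE = 0) {F : ℝ → ℝ} (hF : Continuous F) :
    ∫ x, F x * h x ∂volE = 0 := by
  have hhi : Integrable h volE := hh.integrable one_le_two
  set K := ∫ x, ‖h x‖ ∂volE with hK
  have hK0 : 0 ≤ K := integral_nonneg fun _ => norm_nonneg _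
  refine norm_le_zero_iff.1 (le_of_forall_pos_le_add fun ε hε => ?_)
  -- Weierstrass approximation; `K + 1` keeps the denominator positive when `h` is zero.
  obtain ⟨p, hp⟩ := exists_polynomial_near_of_continuousOn 0 1 F hF.continuousOn (ε / (K + 1))
    (by positivity)
  have h1 : ∫ x, F x * h x ∂volE = ∫ x, (F x - p.eval x) * h x ∂volE := by
    simp only [sub_mul]
    rw [integral_sub (integrable_continuous_mul hF hh)
      (integrable_continuous_mul p.continuous hh), integral_polynomial_mul_eq_zero hh h0,
      sub_zero]
  rw [h1, zero_add]
  calc ‖∫ x, (F x - p.eval x) * h x ∂volE‖ ≤ ∫ x, ε / (K + 1) * ‖h x‖ ∂volE := by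
        refine norm_integral_le_of_norm_le (hhi.norm.const_mul _) ?_
        filter_upwards [ae_volE_mem] with x hx
        rw [norm_mul, norm_sub_rev]
        gcongr
        exact (hp x (Ioo_subset_Icc_self hx)).le
    _ = ε * (K / (K + 1)) := by rw [integral_const_mul, ← hK]; ring
    _ ≤ ε := by
        refine mul_le_of_le_one_right hε.le ?_
        rw [div_le_one (by positivity)]; linarith

lemma ae_eq_zero_of_test {h : ℝ → ℝ} (hh : Integrable h volE)
    (h0 : ∀ φ : ℝ → ℝ, ContDiff ℝ ∞ φ → HasCompactSupport φ → tsupport φ ⊆ Ioo 0 1 →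
      ∫ x, φ x * h x ∂volE = 0) : h =ᵐ[volE] 0 := by
  have h1 := isOpen_Ioo.ae_eq_zero_of_integral_contDiff_smul_eq_zero (U := Ioo (0 : ℝ) 1)
    (μ := volume) (f := h) (IntegrableOn.locallyIntegrableOn hh) (fun φ hφ hc hs => by
      rw [← h0 φ hφ hc hs, integral_volE_eq_volume]
      · rfl
      · intro x hx
        rw [image_eq_zero_of_notMem_tsupport fun h' => hx (hs h'), zero_mul])
  exact (ae_restrict_iff' measurableSet_Ioo).2 h1

/-- The shifted Legendre functions form a Hilbert basis of `L²(0, 1)`. -/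
def legendreBasis : HilbertBasis ℕ ℝ (Lp ℝ 2 volE) :=
  HilbertBasis.mkOfOrthogonalEqBot orthonormal_legendreLp <| by
    refine (Submodule.eq_bot_iff _).2 fun h hmem => ?_
    have h0 : ∀ n, ∫ x, legendreBar n x * h x ∂volE = 0 := fun n => by
      rw [← inner_toLp (memLp_volE_of_continuous (continuous_legendreBar n))]
      exact (Submodule.mem_orthogonal _ _).1 hmem _ (Submodule.subset_span ⟨n, rfl⟩)
    have hL := Lp.memLp h
    have := ae_eq_zero_of_test (hL.integrable one_le_two) fun φ hφ _ _ =>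
      integral_continuous_mul_eq_zero hL h0 hφ.continuous
    exact (Lp.eq_zero_iff_ae_eq_zero).2 this

lemma legendreBasis_apply (n : ℕ) : legendreBasis n = legendreLp n := by
  rw [legendreBasis, HilbertBasis.coe_mkOfOrthogonalEqBot]

/-- Parseval's identity as an error bound for finite Legendre sums. -/
lemma eLpNorm_sub_legendreSum_le {f : ℝ → ℝ} (hf : MemLp f 2 volE) (d : ℕ → ℝ) (N : ℕ) {S : ℝ}
    (hS : 0 ≤ S)
    (hbound : ∀ M, ∑ n ∈ Finset.range M, ((∫ x, f x * legendreBar n x ∂volE) -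
      if n < N + 1 then d n else 0) ^ 2 ≤ S ^ 2) :
    eLpNorm (fun x => f x - ∑ n ∈ Finset.range (N + 1), d n * legendreBar n x) 2 volE ≤
      ENNReal.ofReal S := by
  set r : Lp ℝ 2 volE := hf.toLp f - ∑ n ∈ Finset.range (N + 1), d n • legendreLp n with hr
  have hcoe : r =ᵐ[volE] fun x => f x - ∑ n ∈ Finset.range (N + 1), d n * legendreBar n x := by
    have h1 : ∀ M : ℕ, (∑ n ∈ Finset.range M, d n • legendreLp n : Lp ℝ 2 volE) =ᵐ[volE]
        fun x => ∑ n ∈ Finset.range M, d n * legendreBar n x := fun M => by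
      induction M with
      | zero =>
        filter_upwards [Lp.coeFn_zero ℝ 2 volE] with x hx
        simpa using hx
      | succ M ih =>
        simp only [Finset.sum_range_succ]
        filter_upwards [Lp.coeFn_add (∑ n ∈ Finset.range M, d n • legendreLp n)
          (d M • legendreLp M), ih, Lp.coeFn_smul (d M) (legendreLp M),
          (memLp_volE_of_continuous (continuous_legendreBar M)).coeFn_toLp] with x a b c e
        rw [a, Pi.add_apply, b, c, Pi.smul_apply, legendreLp, e, smul_eq_mul]
    filter_upwards [Lp.coeFn_sub (hf.toLp f) (∑ n ∈ Finset.range (N + 1), d n • legendreLp n),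
      hf.coeFn_toLp, h1 (N + 1)] with x a b c
    rw [hr, a, Pi.sub_apply, b, c]
  have hinner : ∀ n, inner ℝ (legendreBasis n) r = (∫ x, f x * legendreBar n x ∂volE) -
      if n < N + 1 then d n else 0 := fun n => by
    rw [legendreBasis_apply, hr, inner_sub_right, inner_sum]
    congr 1
    · rw [real_inner_comm, inner_toLp]
      refine integral_congr_ae ?_
      filter_upwards [(memLp_volE_of_continuous (continuous_legendreBar n)).coeFn_toLp] with x hx
      rw [legendreLp, hx]
    · simp only [inner_smul_right, orthonormal_iff_ite.1 orthonormal_legendreLp]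
      simp
  have hP := legendreBasis.hasSum_inner_mul_inner r r
  rw [real_inner_self_eq_norm_sq] at hP
  have hle : ‖r‖ ^ 2 ≤ S ^ 2 := by
    rw [← hP.tsum_eq]
    -- The terms are squares of coefficients, so bounds on all partial sums suffice.
    refine Real.tsum_le_of_sum_range_le (fun n => ?_) fun M => ?_
    · rw [real_inner_comm]; exact mul_self_nonneg _
    · refine le_trans (le_of_eq (Finset.sum_congr rfl fun n _ => ?_)) (hbound M)
      rw [real_inner_comm, hinner, sq]
  have hnorm : ‖r‖ ≤ S := (sq_le_sq₀ (norm_nonneg _) hS).1 hle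
  rw [← eLpNorm_congr_ae hcoe, ← ENNReal.ofReal_toReal (Lp.eLpNorm_ne_top r), ← Lp.norm_def]
  exact ENNReal.ofReal_le_ofReal hnorm

/-! ### Weak derivatives and primitives (the du Bois-Reymond lemma). -/

lemma absolutelyContinuousOnInterval_of_contDiff {φ : ℝ → ℝ} (hφ : ContDiff ℝ 1 φ) (a b : ℝ) :
    AbsolutelyContinuousOnInterval φ a b :=
  hφ.contDiffOn.absolutelyContinuousOnInterval

lemma intervalIntegrable_of_volE {v : ℝ → ℝ} (hv : Integrable v volE) :
    IntervalIntegrable v volume 0 1 := by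
  rw [intervalIntegrable_iff_integrableOn_Ioo_of_le zero_le_one]
  exact hv

lemma integral_primitive_mul_deriv {v φ : ℝ → ℝ} {b : ℝ} (hv : IntervalIntegrable v volume 0 b)
    (hφ : ContDiff ℝ 1 φ) :
    ∫ x in (0 : ℝ)..b, (∫ y in (0 : ℝ)..x, v y) * deriv φ x =
      (∫ y in (0 : ℝ)..b, v y) * φ b - ∫ x in (0 : ℝ)..b, v x * φ x := by
  have hV := hv.absolutelyContinuousOnInterval_intervalIntegral (c := 0) (by simp)
  rw [hV.integral_mul_deriv_eq_deriv_mul (absolutelyContinuousOnInterval_of_contDiff hφ 0 b)]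
  simp only [intervalIntegral.integral_same, zero_mul, sub_zero]
  congr 1
  refine intervalIntegral.integral_congr_ae ?_
  filter_upwards [hv.ae_hasDerivAt_integral] with x hx hxm
  rw [(hx (uIoc_subset_uIcc hxm) 0 (by simp)).deriv]

lemma exists_Icc_of_tsupport {θ : ℝ → ℝ} (hc : HasCompactSupport θ) (hs : tsupport θ ⊆ Ioo 0 1) :
    ∃ a b : ℝ, 0 < a ∧ b < 1 ∧ ∀ x, x ∉ Icc a b → θ x = 0 := by
  -- The point `1 / 2` is adjoined only to make the compact set nonempty.
  have hK : IsCompact (tsupport θ ∪ {1 / 2}) := hc.isCompact.union isCompact_singleton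
  have hKs : tsupport θ ∪ {1 / 2} ⊆ Ioo 0 1 :=
    union_subset hs (singleton_subset_iff.2 ⟨by norm_num, by norm_num⟩)
  have hne : (tsupport θ ∪ {1 / 2}).Nonempty := ⟨1 / 2, by simp⟩
  obtain ⟨a, ha⟩ := hK.exists_isLeast hne
  obtain ⟨b, hb⟩ := hK.exists_isGreatest hne
  refine ⟨a, b, (hKs ha.1).1, (hKs hb.1).2, fun x hx => ?_⟩
  refine image_eq_zero_of_notMem_tsupport fun h => hx ⟨ha.2 (Or.inl h), hb.2 (Or.inl h)⟩

/-- A test function of mean zero is the derivative of a test function. -/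
lemma exists_test_primitive {θ : ℝ → ℝ} (hθ : ContDiff ℝ ∞ θ) (hc : HasCompactSupport θ)
    (hs : tsupport θ ⊆ Ioo 0 1) (hmean : ∫ x, θ x ∂volE = 0) :
    ∃ φ : ℝ → ℝ, ContDiff ℝ ∞ φ ∧ HasCompactSupport φ ∧ tsupport φ ⊆ Ioo 0 1 ∧ deriv φ = θ := by
  obtain ⟨a, b, ha, hb, hab⟩ := exists_Icc_of_tsupport hc hs
  set φ : ℝ → ℝ := fun x => ∫ y in (0 : ℝ)..x, θ y with hφ
  have hderiv : deriv φ = θ := funext fun x => hθ.continuous.deriv_integral _ 0 x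
  have hzero : ∀ x, x ∉ Icc a b → φ x = 0 := fun x hx => by
    rcases lt_or_ge x a with h | h
    · refine intervalIntegral.integral_zero_ae (Eventually.of_forall fun y hy => hab y fun hy' => ?_)
      rcases mem_uIoc.1 hy with h' | h' <;> linarith [h'.1, h'.2, hy'.1]
    · have hbx : b < x := by
        by_contra h'
        exact hx ⟨h, not_lt.1 h'⟩
      rw [integral_volE_eq_interval] at hmean
      have h1 := intervalIntegral.integral_add_adjacent_intervals
        (hθ.continuous.intervalIntegrable 0 x) (hθ.continuous.intervalIntegrable (μ := volume) x 1)
      have h2 : ∫ y in x..1, θ y = 0 := by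
        refine intervalIntegral.integral_zero_ae
          (Eventually.of_forall fun y hy => hab y fun hy' => ?_)
        rcases mem_uIoc.1 hy with h' | h' <;> linarith [h'.1, h'.2, hy'.2]
      rw [hmean, h2, add_zero] at h1
      exact h1
  have hsupp : tsupport φ ⊆ Icc a b :=
    closure_minimal (fun x hx => by
      by_contra h
      exact hx (hzero x h)) isClosed_Icc
  refine ⟨φ, contDiff_infty_iff_deriv.2 ⟨fun x => ?_, hderiv ▸ hθ⟩,
    HasCompactSupport.intro isCompact_Icc hzero,
    hsupp.trans fun x hx => ⟨ha.trans_le hx.1, hx.2.trans_lt hb⟩, hderiv⟩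
  exact (intervalIntegral.integral_hasDerivAt_right (hθ.continuous.intervalIntegrable _ _)
    (hθ.continuous.stronglyMeasurableAtFilter _ _) hθ.continuous.continuousAt).differentiableAt

lemma exists_test_integral_one : ∃ ψ : ℝ → ℝ, ContDiff ℝ ∞ ψ ∧ HasCompactSupport ψ ∧
    tsupport ψ ⊆ Ioo 0 1 ∧ ∫ x, ψ x ∂volE = 1 := by
  let B : ContDiffBump (1 / 2 : ℝ) := ⟨1 / 8, 1 / 4, by norm_num, by norm_num⟩
  have hs : tsupport (B.normed volume) ⊆ Ioo 0 1 := by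
    rw [B.tsupport_normed_eq, Real.closedBall_eq_Icc]
    intro x hx
    have h1 := hx.1
    have h2 := hx.2
    simp only [B] at h1 h2
    constructor <;> linarith
  refine ⟨B.normed volume, B.contDiff_normed, B.hasCompactSupport_normed, hs, ?_⟩
  rw [integral_volE_eq_volume fun x hx => image_eq_zero_of_notMem_tsupport fun h => hx (hs h)]
  exact B.integral_normed

lemma integrable_mul_of_continuous {u F : ℝ → ℝ} (hu : Integrable u volE) (hF : Continuous F) :
    Integrable (fun x => u x * F x) volE := by
  obtain ⟨M, hM⟩ := isCompact_Icc.exists_bound_of_continuousOn (hF.continuousOn (s := Icc 0 1))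
  refine hu.mul_bdd (c := M) hF.aestronglyMeasurable ?_
  filter_upwards [ae_volE_mem] with y hy using hM y (Ioo_subset_Icc_self hy)

lemma integrable_primitive {v : ℝ → ℝ} (hv : Integrable v volE) :
    Integrable (fun x => ∫ y in (0 : ℝ)..x, v y) volE := by
  have h := (intervalIntegrable_of_volE hv).absolutelyContinuousOnInterval_intervalIntegral
    (c := 0) (by simp)
  have := h.continuousOn.intervalIntegrable (μ := volume)
  rwa [intervalIntegrable_iff_integrableOn_Ioo_of_le zero_le_one] at this

/-- A function whose weak derivative is `v` is a primitive of `v` up to a constant. -/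
lemma exists_const_add_primitive {u v : ℝ → ℝ} (hu : Integrable u volE) (hv : Integrable v volE)
    (h : ∀ φ : ℝ → ℝ, ContDiff ℝ ∞ φ → HasCompactSupport φ → tsupport φ ⊆ Ioo 0 1 →
      ∫ x, u x * deriv φ x ∂volE = -∫ x, v x * φ x ∂volE) :
    ∃ c : ℝ, u =ᵐ[volE] fun x => c + ∫ y in (0 : ℝ)..x, v y := by
  obtain ⟨ψ₀, hψ₀, hψ₀c, hψ₀s, hψ₀i⟩ := exists_test_integral_one
  set V : ℝ → ℝ := fun x => ∫ y in (0 : ℝ)..x, v y with hV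
  have hVi : Integrable V volE := integrable_primitive hv
  have hw : Integrable (fun x => u x - V x) volE := hu.sub hVi
  have hwd : ∀ φ : ℝ → ℝ, ContDiff ℝ ∞ φ → HasCompactSupport φ → tsupport φ ⊆ Ioo 0 1 →
      ∫ x, (u x - V x) * deriv φ x ∂volE = 0 := fun φ hφ hφc hφs => by
    have hd : Continuous (deriv φ) := hφ.continuous_deriv (by simp)
    simp only [sub_mul]
    rw [integral_sub (integrable_mul_of_continuous hu hd) (integrable_mul_of_continuous hVi hd),
      h φ hφ hφc hφs, integral_volE_eq_interval, integral_volE_eq_interval,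
      integral_primitive_mul_deriv (intervalIntegrable_of_volE hv) (hφ.of_le (by simp)),
      image_eq_zero_of_notMem_tsupport (x := (1 : ℝ)) fun h => lt_irrefl _ (hφs h).2]
    ring
  set c := ∫ x, (u x - V x) * ψ₀ x ∂volE with hc
  refine ⟨c, ?_⟩
  have hz : (fun x => u x - V x - c) =ᵐ[volE] 0 := by
    refine ae_eq_zero_of_test (hw.sub (integrable_const c)) fun ψ hψ hψc hψs => ?_
    set I := ∫ x, ψ x ∂volE with hI
    have hψi : Integrable ψ volE := (memLp_volE_of_continuous hψ.continuous).integrable one_le_two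
    have hψ₀i' : Integrable ψ₀ volE :=
      (memLp_volE_of_continuous hψ₀.continuous).integrable one_le_two
    have hsub : tsupport (fun x => ψ x - I * ψ₀ x) ⊆ tsupport ψ ∪ tsupport ψ₀ := by
      refine closure_minimal (fun x hx => ?_) ((isClosed_tsupport _).union (isClosed_tsupport _))
      by_contra h'
      rw [mem_union, not_or] at h'
      refine hx ?_
      simp only
      rw [image_eq_zero_of_notMem_tsupport h'.1, image_eq_zero_of_notMem_tsupport h'.2]
      simp
    -- Subtracting `I * ψ₀` leaves mean zero, so the difference is the derivative of a test
    -- function, against which `u - V` integrates to zero. Hence `∫ (u - V) ψ = c ∫ ψ`.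
    obtain ⟨φ, hφ, hφc, hφs, hφd⟩ := exists_test_primitive (θ := fun x => ψ x - I * ψ₀ x)
      (hψ.sub (contDiff_const.mul hψ₀))
      ((hψc.isCompact.union hψ₀c.isCompact).of_isClosed_subset (isClosed_tsupport _) hsub)
      (hsub.trans (union_subset hψs hψ₀s)) (by
        rw [integral_sub hψi (hψ₀i'.const_mul I), integral_const_mul, hψ₀i]; simp [hI])
    have h0 := hwd φ hφ hφc hφs
    rw [hφd] at h0
    have e1 : ∀ x, (u x - V x) * (ψ x - I * ψ₀ x) =
        (u x - V x) * ψ x - I * ((u x - V x) * ψ₀ x) := fun x => by ring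
    simp only [e1] at h0
    rw [integral_sub (integrable_mul_of_continuous hw hψ.continuous)
      ((integrable_mul_of_continuous hw hψ₀.continuous).const_mul I), integral_const_mul,
      ← hc] at h0
    have e2 : ∀ x, ψ x * (u x - V x - c) = (u x - V x) * ψ x - c * ψ x := fun x => by ring
    simp only [e2]
    rw [integral_sub (integrable_mul_of_continuous hw hψ.continuous) (hψi.const_mul c),
      integral_const_mul, ← hI]
    linarith
  filter_upwards [hz] with x hx
  simp only [Pi.zero_apply] at hx
  linarith

/-! ### Chains of primitives representing a Sobolev function. -/

/-- Each `w j` with `j < k` is a primitive of `w (j + 1)`, and `w k` is locally integrable. -/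
def IsPrimitiveChain (k : ℕ) (w : ℕ → ℝ → ℝ) : Prop :=
  (∀ a b : ℝ, IntervalIntegrable (w k) volume a b) ∧
    ∀ j < k, ∀ x, w j x = w j 0 + ∫ y in (0 : ℝ)..x, w (j + 1) y

lemma exists_isPrimitiveChain (m : ℕ) (v : ℕ → ℝ → ℝ) (hv : Integrable (v m) volE)
    (h : ∀ j < m, ∃ c : ℝ, v j =ᵐ[volE] fun x => c + ∫ y in (0 : ℝ)..x, v (j + 1) y) :
    ∃ w, IsPrimitiveChain m w ∧ v 0 =ᵐ[volE] w 0 := by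
  induction m generalizing v with
  | zero =>
    -- Extension by zero makes the top derivative integrable over every interval, so the chain lives
    -- on all of `ℝ`.
    refine ⟨fun _ => (Ioo (0 : ℝ) 1).indicator (v 0), ⟨fun a b => ?_, by simp⟩, ?_⟩
    · exact ((integrable_indicator_iff measurableSet_Ioo).2 hv).intervalIntegrable
    · filter_upwards [ae_volE_mem] with x hx
      rw [indicator_of_mem hx]
  | succ m ih =>
    obtain ⟨w, hw, hw0⟩ := ih (fun j => v (j + 1)) hv fun j hj => h (j + 1) (by lia)
    obtain ⟨c, hc⟩ := h 0 (by lia)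
    let W : ℕ → ℝ → ℝ := fun j => Nat.casesOn j (fun x => c + ∫ y in (0 : ℝ)..x, w 0 y) w
    refine ⟨W, ⟨hw.1, fun j hj x => ?_⟩, ?_⟩
    · cases j with
      | zero => simp [W]
      | succ j => exact hw.2 j (by lia) x
    · filter_upwards [hc, ae_volE_mem] with x hx hxm
      rw [hx]
      simp only [W]
      congr 1
      rw [intervalIntegral.integral_of_le hxm.1.le, intervalIntegral.integral_of_le hxm.1.le,
        integral_Ioc_eq_integral_Ioo, integral_Ioc_eq_integral_Ioo]
      refine integral_congr_ae ?_
      exact ae_restrict_of_ae_restrict_of_subset (Ioo_subset_Ioo_right hxm.2.le) hw0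

lemma integrable_volE_of_memLp {v : ℝ → ℝ} (hv : MemLp v 2 muE) : Integrable v volE :=
  (hv.integrable one_le_two).mono_measure volE_le_muE

/-- The continuous representatives of the weak derivatives of a function in `H^k_μ`. -/
lemma exists_chain_of_memSobolevMu {k : ℕ} {g : ℝ → ℝ} (hg : MemSobolevMu k g) :
    ∃ w, IsPrimitiveChain k w ∧ g =ᵐ[volE] w 0 := by
  obtain ⟨hg0, hg1⟩ := hg
  choose! v hv hvd using hg1
  have hgi := integrable_volE_of_memLp hg0
  have hvi : ∀ j ≤ k, Integrable (v j) volE := fun j hj => integrable_volE_of_memLp (hv j hj)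
  obtain ⟨w, hw, hw0⟩ := exists_isPrimitiveChain k v (hvi k le_rfl) fun j hj => by
    refine exists_const_add_primitive (hvi j hj.le) (hvi (j + 1) hj) fun φ hφ hφc hφs => ?_
    -- Each `v j` is a weak derivative of `g` of its own order; testing order `j` against `deriv φ`
    -- and order `j + 1` against `φ` links consecutive ones.
    have hd : ContDiff ℝ ∞ (deriv φ) := (contDiff_infty_iff_deriv.1 hφ).2
    have h1 := hvd j hj.le (deriv φ) hd hφc.deriv ((tsupport_deriv_subset).trans hφs)
    have h2 := hvd (j + 1) hj φ hφ hφc hφs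
    rw [iteratedDeriv_succ', h1, pow_succ, mul_assoc] at h2
    have := mul_left_cancel₀ (pow_ne_zero j (by norm_num : (-1 : ℝ) ≠ 0)) h2
    simpa using this
  refine ⟨w, hw, EventuallyEq.trans ?_ hw0⟩
  have hz : (fun x => g x - v 0 x) =ᵐ[volE] 0 := by
    refine ae_eq_zero_of_test (hgi.sub (hvi 0 (by lia))) fun φ hφ hφc hφs => ?_
    have h1 := hvd 0 (by lia) φ hφ hφc hφs
    simp only [iteratedDeriv_zero, pow_zero, one_mul] at h1
    have e : ∀ x, φ x * (g x - v 0 x) = g x * φ x - v 0 x * φ x := fun x => by ring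
    simp only [e]
    rw [integral_sub (integrable_mul_of_continuous hgi hφ.continuous)
      (integrable_mul_of_continuous (hvi 0 (by lia)) hφ.continuous), h1, sub_self]
  filter_upwards [hz] with x hx
  exact sub_eq_zero.1 hx

namespace IsPrimitiveChain

variable {k : ℕ} {w : ℕ → ℝ → ℝ}

lemma intervalIntegrable (hw : IsPrimitiveChain k w) {j : ℕ} (hj : j ≤ k) (a b : ℝ) :
    IntervalIntegrable (w j) volume a b := by
  induction hj using Nat.decreasingInduction generalizing a b with
  | self => exact hw.1 a b
  | of_succ j hj ih =>
    have : Continuous (w j) := by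
      rw [funext (hw.2 j hj)]
      exact continuous_const.add (intervalIntegral.continuous_primitive ih 0)
    exact this.intervalIntegrable a b

lemma continuous (hw : IsPrimitiveChain k w) {j : ℕ} (hj : j < k) : Continuous (w j) := by
  rw [funext (hw.2 j hj)]
  exact continuous_const.add
    (intervalIntegral.continuous_primitive (hw.intervalIntegrable (j := j + 1) hj) 0)

lemma hasDerivAt (hw : IsPrimitiveChain k w) {j : ℕ} (hj : j + 1 < k) (x : ℝ) :
    HasDerivAt (w j) (w (j + 1) x) x := by
  have hc := hw.continuous hj
  rw [funext (hw.2 j (by lia))]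
  exact (intervalIntegral.integral_hasDerivAt_right (hc.intervalIntegrable _ _)
    (hc.stronglyMeasurableAtFilter _ _) hc.continuousAt).const_add _

end IsPrimitiveChain

/-! ### From almost everywhere to pointwise equality. -/

lemma ae_eq_of_integral_eq {f F : ℝ → ℝ} (hf : Integrable f volE) (hF : Integrable F volE)
    (h : ∀ x ∈ Icc (0 : ℝ) 1, ∫ y in (0 : ℝ)..x, f y = ∫ y in (0 : ℝ)..x, F y) :
    f =ᵐ[volE] F := by
  have h1 := (intervalIntegrable_of_volE hf).ae_hasDerivAt_integral
  have h2 := (intervalIntegrable_of_volE hF).ae_hasDerivAt_integral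
  filter_upwards [ae_restrict_of_ae h1, ae_restrict_of_ae h2, ae_volE_mem] with x hx1 hx2 hxm
  have hxm' : x ∈ uIcc (0 : ℝ) 1 := by
    rw [uIcc_of_le zero_le_one]; exact Ioo_subset_Icc_self hxm
  have d1 := hx1 hxm' 0 (by simp)
  have d2 := hx2 hxm' 0 (by simp)
  refine d1.unique (d2.congr_of_eventuallyEq ?_)
  filter_upwards [isOpen_Ioo.mem_nhds hxm] with y hy using h y (Ioo_subset_Icc_self hy)

/-- If an Abel transform agrees almost everywhere with a primitive vanishing at the origin, it
agrees with it everywhere on `[0, 1]`. -/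
lemma abelTransform_eq_primitive {f v : ℝ → ℝ} (hf : Integrable f volE) (hv : Integrable v volE)
    (h : abelTransform f =ᵐ[volE] fun x => ∫ y in (0 : ℝ)..x, v y) {x : ℝ}
    (hx : x ∈ Icc (0 : ℝ) 1) : abelTransform f x = ∫ y in (0 : ℝ)..x, v y := by
  -- By `A ∘ A = π ∫`, this `F` solves `A F = ∫ v` at every point of `[0, 1]`.
  set F : ℝ → ℝ := fun x => (1 / Real.pi) * abelTransform v x with hF
  have hFi : Integrable F volE := (integrable_abelTransform hv).const_mul _
  have hAF : ∀ x ∈ Icc (0 : ℝ) 1, abelTransform F x = ∫ y in (0 : ℝ)..x, v y := fun x hx => by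
    have h1 : abelTransform F x = (1 / Real.pi) * abelTransform (abelTransform v) x := by
      rw [abelTransform, abelTransform, ← intervalIntegral.integral_const_mul]
      simp only [hF, mul_div_assoc]
    rw [h1, abelTransform_abelTransform hv hx, ← mul_assoc, one_div_mul_cancel Real.pi_ne_zero,
      one_mul]
  -- Applying `A` once more turns `A f = A F` a.e. into equality of primitives, hence `f = F` a.e.
  -- Changing `f` on a null set changes `A f` at no point of `[0, 1]`, so the a.e. equality becomes
  -- pointwise.
  have hfF : f =ᵐ[volE] F := by
    refine ae_eq_of_integral_eq hf hFi fun y hy => ?_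
    have h1 := abelTransform_abelTransform hf hy
    have h2 := abelTransform_abelTransform hFi hy
    rw [abelTransform_congr (f' := abelTransform F) _ hy, h2] at h1
    · exact (mul_left_cancel₀ Real.pi_ne_zero h1).symm
    · filter_upwards [h, ae_volE_mem] with z hz hzm
      rw [hz, hAF z (Ioo_subset_Icc_self hzm)]
  rw [abelTransform_congr hfF hx, hAF x hx]

/-- If `g (sin² (t/2))` tends to `0` at the origin, so does any continuous representative. -/
lemma representative_zero {g w : ℝ → ℝ} (hw : Continuous w) (h : g =ᵐ[volE] w)
    (hg : Tendsto (fun t => g (halfSinSq t)) (𝓝[≠] 0) (𝓝 0)) : w 0 = 0 := by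
  have h1 : ∀ᵐ t ∂volume.restrict (Ioo 0 Real.pi), g (halfSinSq t) = w (halfSinSq t) :=
    measurePreserving_halfSinSq.quasiMeasurePreserving.ae (absolutelyContinuous_muE.ae_le h)
  have h2 : Tendsto (fun t => w (halfSinSq t)) (𝓝[≠] 0) (𝓝 (w 0)) := by
    have := (hw.comp continuous_halfSinSq).tendsto 0
    simp only [Function.comp, halfSinSq_zero] at this
    exact this.mono_left nhdsWithin_le_nhds
  by_contra hne
  -- Otherwise `g` and `w` would differ along a whole punctured neighbourhood of `0`, contradicting
  -- equality for almost every `t`.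
  have h3 : ∀ᶠ t in 𝓝[≠] 0, w (halfSinSq t) - g (halfSinSq t) ≠ 0 :=
    (h2.sub hg).eventually_ne (by simpa using hne)
  obtain ⟨δ, hδ, hδ'⟩ := Metric.mem_nhdsWithin_iff.1 h3
  set d := min δ Real.pi with hd
  have hd0 : 0 < d := lt_min hδ Real.pi_pos
  have h4 : ∀ᵐ t ∂volume.restrict (Ioo 0 d), g (halfSinSq t) = w (halfSinSq t) :=
    ae_restrict_of_ae_restrict_of_subset (Ioo_subset_Ioo_right (min_le_right _ _)) h1
  have : (ae (volume.restrict (Ioo 0 d))).NeBot := by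
    rw [ae_neBot, Ne, Measure.restrict_eq_zero]
    simp [hd0]
  obtain ⟨t, ht, htm⟩ := (h4.and (ae_restrict_mem measurableSet_Ioo)).exists
  have h5 : t ∈ Metric.ball (0 : ℝ) δ ∩ {0}ᶜ := by
    refine ⟨?_, by simpa using htm.1.ne'⟩
    rw [Metric.mem_ball, Real.dist_eq, sub_zero, abs_of_pos htm.1]
    exact htm.2.trans_le (min_le_left _ _)
  exact hδ' h5 (by rw [ht, sub_self])

/-! ### Absolute continuity of the derivatives of `w₀ (sin² (t/2))`. -/

-- Monotonicity of `s` keeps the image intervals disjoint and the Lipschitz bound controls their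
-- total length; `K + 1` avoids dividing by zero.
open AbsolutelyContinuousOnInterval in
lemma absolutelyContinuousOnInterval_comp {f s : ℝ → ℝ} {a b c d : ℝ} {K : NNReal}
    (hf : AbsolutelyContinuousOnInterval f c d) (hs : MonotoneOn s (uIcc a b))
    (hK : LipschitzOnWith K s (uIcc a b)) (hm : MapsTo s (uIcc a b) (uIcc c d)) :
    AbsolutelyContinuousOnInterval (fun t => f (s t)) a b := by
  rw [absolutelyContinuousOnInterval_iff] at hf ⊢
  intro ε hε
  obtain ⟨δ, hδ, h⟩ := hf ε hε
  refine ⟨δ / (K + 1), by positivity, ?_⟩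
  rintro ⟨n, I⟩ ⟨hI, hdisj⟩ hlen
  refine h (n, fun i => (s (I i).1, s (I i).2)) ⟨fun i hi => ⟨hm (hI i hi).1, hm (hI i hi).2⟩, ?_⟩ ?_
  · intro i hi j hj hij
    have hdis := hdisj hi hj hij
    have hi' := hI i hi
    have hj' := hI j hj
    simp only [Function.onFun, uIoc, Ioc_disjoint_Ioc] at hdis ⊢
    rw [← hs.map_max hi'.1 hi'.2, ← hs.map_min hi'.1 hi'.2, ← hs.map_max hj'.1 hj'.2,
      ← hs.map_min hj'.1 hj'.2]
    have hmax : ∀ {x y : ℝ}, x ∈ uIcc a b → y ∈ uIcc a b → max x y ∈ uIcc a b := fun {x y} hx hy => by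
      rcases max_choice x y with h | h <;> rw [h] <;> assumption
    have hmin : ∀ {x y : ℝ}, x ∈ uIcc a b → y ∈ uIcc a b → min x y ∈ uIcc a b := fun {x y} hx hy => by
      rcases min_choice x y with h | h <;> rw [h] <;> assumption
    rw [← hs.map_min (hmax hi'.1 hi'.2) (hmax hj'.1 hj'.2),
      ← hs.map_max (hmin hi'.1 hi'.2) (hmin hj'.1 hj'.2)]
    exact hs (hmin (hmax hi'.1 hi'.2) (hmax hj'.1 hj'.2))
      (hmax (hmin hi'.1 hi'.2) (hmin hj'.1 hj'.2)) hdis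
  · calc ∑ i ∈ Finset.range n, dist (s (I i).1) (s (I i).2)
        ≤ ∑ i ∈ Finset.range n, (K + 1) * dist (I i).1 (I i).2 := by
          refine Finset.sum_le_sum fun i hi => ?_
          refine (hK.dist_le_mul _ (hI i hi).1 _ (hI i hi).2).trans ?_
          gcongr
          linarith
      _ = (K + 1) * ∑ i ∈ Finset.range n, dist (I i).1 (I i).2 := by rw [Finset.mul_sum]
      _ < (K + 1) * (δ / (K + 1)) := by gcongr
      _ = δ := by field_simp

lemma absolutelyContinuousOnInterval_sum {ι : Type*} (S : Finset ι) {F : ι → ℝ → ℝ} {a b : ℝ}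
    (h : ∀ i ∈ S, AbsolutelyContinuousOnInterval (F i) a b) :
    AbsolutelyContinuousOnInterval (fun t => ∑ i ∈ S, F i t) a b := by
  classical
  induction S using Finset.induction_on with
  | empty =>
    simp only [Finset.sum_empty]
    exact absolutelyContinuousOnInterval_of_contDiff contDiff_const a b
  | insert i S hi ih =>
    simp only [Finset.sum_insert hi]
    exact (h i (Finset.mem_insert_self i S)).fun_add
      (ih fun j hj => h j (Finset.mem_insert_of_mem hj))

namespace IsPrimitiveChain

variable {k : ℕ} {w : ℕ → ℝ → ℝ}

lemma absolutelyContinuous (hw : IsPrimitiveChain k w) {j : ℕ} (hj : j < k) :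
    AbsolutelyContinuousOnInterval (w j) 0 1 := by
  rw [funext (hw.2 j hj)]
  exact (absolutelyContinuousOnInterval_of_contDiff contDiff_const 0 1).fun_add
    ((hw.intervalIntegrable (j := j + 1) hj 0 1).absolutelyContinuousOnInterval_intervalIntegral
      (by simp))

lemma absolutelyContinuous_comp (hw : IsPrimitiveChain k w) {j : ℕ} (hj : j < k) :
    AbsolutelyContinuousOnInterval (fun t => w j (halfSinSq t)) 0 Real.pi := by
  obtain ⟨K, hK⟩ := (contDiff_halfSinSq.contDiffOn (s := uIcc 0 Real.pi)).exists_lipschitzOnWith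
    (by simp) (convex_uIcc _ _) isCompact_uIcc
  refine absolutelyContinuousOnInterval_comp (hw.absolutelyContinuous hj) ?_ hK fun t _ => ?_
  · rw [uIcc_of_le Real.pi_pos.le]
    exact strictMonoOn_halfSinSq.monotoneOn
  · rw [uIcc_of_le zero_le_one]
    exact halfSinSq_mem_Icc t

/-- The derivatives of `t ↦ w₀ (sin² (t / 2))` are combinations of the `wᵢ (sin² (t / 2))`
with smooth coefficients. -/
lemma exists_iteratedDeriv_comp (hw : IsPrimitiveChain k w) {m : ℕ} (hm : m < k) :
    ∃ p : ℕ → ℝ → ℝ, (∀ i, ContDiff ℝ ∞ (p i)) ∧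
      iteratedDeriv m (fun t => w 0 (halfSinSq t)) =
        fun t => ∑ i ∈ Finset.range (m + 1), p i t * w i (halfSinSq t) := by
  induction m with
  | zero => exact ⟨fun _ _ => 1, fun _ => contDiff_const, by simp⟩
  | succ m ih =>
    obtain ⟨p, hp, hpm⟩ := ih (by lia)
    -- Differentiating `wᵢ ∘ halfSinSq` raises the index by one, so `q` is the shifted coefficient
    -- times the inner derivative. The guard `i < m + 1` below discards the derivative of `p (m +
    -- 1)`, which does not occur at order `m`.
    let q : ℕ → ℝ → ℝ := fun i => Nat.casesOn i (fun _ => 0) fun i t => p i t * deriv halfSinSq t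
    have hq : ∀ i, ContDiff ℝ ∞ (q i) := fun i => by
      cases i with
      | zero => exact contDiff_const
      | succ i => exact (hp i).mul (contDiff_infty_iff_deriv.1 contDiff_halfSinSq).2
    refine ⟨fun i t => (if i < m + 1 then deriv (p i) t else 0) + q i t, fun i => ?_, ?_⟩
    · refine ContDiff.add ?_ (hq i)
      split_ifs
      · exact (contDiff_infty_iff_deriv.1 (hp i)).2
      · exact contDiff_const
    · rw [iteratedDeriv_succ, hpm]
      funext t
      have hd : HasDerivAt (fun t => ∑ i ∈ Finset.range (m + 1), p i t * w i (halfSinSq t))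
          (∑ i ∈ Finset.range (m + 1), (deriv (p i) t * w i (halfSinSq t) +
            p i t * (w (i + 1) (halfSinSq t) * deriv halfSinSq t))) t := by
        refine HasDerivAt.fun_sum fun i hi => ?_
        rw [Finset.mem_range] at hi
        refine HasDerivAt.fun_mul ((contDiff_infty_iff_deriv.1 (hp i)).1 t).hasDerivAt ?_
        exact (hw.hasDerivAt (j := i) (by lia) (halfSinSq t)).comp t
          (hasDerivAt_halfSinSq t).differentiableAt.hasDerivAt
      rw [hd.deriv]
      simp only [add_mul]
      rw [Finset.sum_add_distrib, Finset.sum_add_distrib,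
        Finset.sum_range_succ _ (m + 1), Finset.sum_range_succ' _ (m + 1)]
      have hq0 : q 0 t = 0 := rfl
      have hqs : ∀ i, q (i + 1) t = p i t * deriv halfSinSq t := fun _ => rfl
      simp only [hq0, hqs, lt_irrefl, if_false, zero_mul, add_zero]
      refine congrArg₂ _ (Finset.sum_congr rfl fun i hi => ?_)
        (Finset.sum_congr rfl fun i _ => by ring)
      rw [if_pos (Finset.mem_range.1 hi)]

lemma continuous_iteratedDeriv_comp (hw : IsPrimitiveChain k w) {m : ℕ} (hm : m < k) :
    Continuous (iteratedDeriv m fun t => w 0 (halfSinSq t)) := by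
  obtain ⟨p, hp, h⟩ := hw.exists_iteratedDeriv_comp hm
  rw [h]
  refine continuous_finsetSum _ fun i hi => (hp i).continuous.mul
    ((hw.continuous ?_).comp continuous_halfSinSq)
  have := Finset.mem_range.1 hi
  lia

lemma absolutelyContinuous_iteratedDeriv_comp (hw : IsPrimitiveChain k w) {m : ℕ} (hm : m < k) :
    AbsolutelyContinuousOnInterval (iteratedDeriv m fun t => w 0 (halfSinSq t)) 0 Real.pi := by
  obtain ⟨p, hp, h⟩ := hw.exists_iteratedDeriv_comp hm
  rw [h]
  refine absolutelyContinuousOnInterval_sum _ fun i hi =>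
    (absolutelyContinuousOnInterval_of_contDiff ((hp i).of_le (by simp)) _ _).fun_mul
      (hw.absolutelyContinuous_comp ?_)
  have := Finset.mem_range.1 hi
  lia

end IsPrimitiveChain

/-! ### Decay of the sine coefficients. -/

/-- `sin² (t/2)` is symmetric about `π`, so an odd derivative there equals its own negative; no
smoothness of `W` is needed. -/
lemma iteratedDeriv_comp_halfSinSq_pi (W : ℝ → ℝ) {j : ℕ} (hj : Odd j) :
    iteratedDeriv j (fun t => W (halfSinSq t)) Real.pi = 0 := by
  have h := iteratedDeriv_comp_const_sub j (fun t => W (halfSinSq t)) (2 * Real.pi)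
  have hsym : (fun t => W (halfSinSq (2 * Real.pi - t))) = fun t => W (halfSinSq t) := by
    funext t
    rw [halfSinSq, show (2 * Real.pi - t) / 2 = Real.pi - t / 2 by ring, Real.sin_pi_sub, halfSinSq]
  rw [hsym] at h
  have h2 := congrFun h Real.pi
  rw [hj.neg_one_pow, show 2 * Real.pi - Real.pi = Real.pi by ring] at h2
  simp only [neg_smul, one_smul] at h2
  linarith

/-- Integration by parts against half-integer sines with vanishing boundary terms. -/
lemma integral_sin_mul_deriv_step {D : ℝ → ℝ} (hD : AbsolutelyContinuousOnInterval D 0 Real.pi)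
    (n j : ℕ) (h0 : D 0 = 0) (hpi : Odd j → D Real.pi = 0) :
    ∫ t in (0 : ℝ)..Real.pi, Real.sin ((n + 1 / 2) * t - j * (Real.pi / 2)) * D t =
      -(1 / (n + 1 / 2)) * ∫ t in (0 : ℝ)..Real.pi,
        Real.sin ((n + 1 / 2) * t - (j + 1 : ℕ) * (Real.pi / 2)) * deriv D t := by
  have hl : (n : ℝ) + 1 / 2 ≠ 0 := by positivity
  -- Shifting the phase by `π/2` integrates the sine, so the integrand keeps one form at every step.
  -- At `t = π` and even `j` the phase is an integer multiple of `π`; for odd `j` the factor `D π`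
  -- vanishes instead.
  set S : ℝ → ℝ := fun t =>
    1 / (n + 1 / 2) * Real.sin ((n + 1 / 2) * t - (j + 1 : ℕ) * (Real.pi / 2)) with hS
  have hSc : ContDiff ℝ 1 S := by rw [hS]; fun_prop
  have hSd : deriv S = fun t => Real.sin ((n + 1 / 2) * t - j * (Real.pi / 2)) := by
    funext t
    have h1 : HasDerivAt (fun t : ℝ => (n + 1 / 2) * t - (j + 1 : ℕ) * (Real.pi / 2))
        ((n : ℝ) + 1 / 2) t := by
      simpa using ((hasDerivAt_id t).const_mul ((n : ℝ) + 1 / 2)).sub_const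
        ((j + 1 : ℕ) * (Real.pi / 2))
    have h2 := (h1.sin.const_mul (1 / ((n : ℝ) + 1 / 2))).deriv
    rw [hS, h2, show (n + 1 / 2) * t - (j + 1 : ℕ) * (Real.pi / 2) =
      ((n + 1 / 2) * t - j * (Real.pi / 2)) - Real.pi / 2 by push_cast; ring, Real.cos_sub_pi_div_two]
    field_simp
  have hbd : D Real.pi * S Real.pi = 0 := by
    rcases Nat.even_or_odd j with hj | hj
    · obtain ⟨i, rfl⟩ := hj
      have : S Real.pi = 0 := by
        simp only [hS]
        rw [show ((n : ℝ) + 1 / 2) * Real.pi - (i + i + 1 : ℕ) * (Real.pi / 2) =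
          ((n - i : ℤ) : ℝ) * Real.pi by push_cast; ring, Real.sin_int_mul_pi, mul_zero]
      rw [this, mul_zero]
    · rw [hpi hj, zero_mul]
  have h := hD.integral_mul_deriv_eq_deriv_mul
    (absolutelyContinuousOnInterval_of_contDiff hSc 0 Real.pi)
  rw [hSd, hbd, h0, zero_mul, sub_zero, zero_sub] at h
  simp only [mul_comm (Real.sin _)]
  rw [h, neg_mul, ← intervalIntegral.integral_const_mul]
  congr 1
  refine intervalIntegral.integral_congr fun t _ => ?_
  simp only [hS]
  ring

/-- Decay of the half-integer sine coefficients of `w₀ (sin² (t / 2))`. -/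
lemma IsPrimitiveChain.sineCoeff_decay {k : ℕ} {w : ℕ → ℝ → ℝ} (hk : 0 < k)
    (hw : IsPrimitiveChain k w)
    (hv : ∀ j < k, iteratedDeriv j (fun t => w 0 (halfSinSq t)) 0 = 0) :
    ∃ C, 0 ≤ C ∧ ∀ n : ℕ, |sineCoeff (w 0) n| ≤ C * (1 / (n + 1 / 2)) ^ k := by
  set D : ℕ → ℝ → ℝ := fun j => iteratedDeriv j fun t => w 0 (halfSinSq t) with hD
  have hstep : ∀ n : ℕ, ∀ j ≤ k,
      ∫ t in (0 : ℝ)..Real.pi, Real.sin ((n + 1 / 2) * t) * w 0 (halfSinSq t) =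
        (-(1 / (n + 1 / 2))) ^ j *
          ∫ t in (0 : ℝ)..Real.pi, Real.sin ((n + 1 / 2) * t - j * (Real.pi / 2)) * D j t := by
    intro n j hj
    induction j with
    | zero => simp [hD]
    | succ j ih =>
      rw [ih (by lia), integral_sin_mul_deriv_step
        (hw.absolutelyContinuous_iteratedDeriv_comp (m := j) (by lia)) n j (hv j (by lia))
        (fun h => iteratedDeriv_comp_halfSinSq_pi (w 0) h), pow_succ, mul_assoc]
      simp only [hD, iteratedDeriv_succ]
  obtain ⟨i, rfl⟩ : ∃ i, k = i + 1 := ⟨k - 1, by lia⟩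
  -- The top derivative exists only almost everywhere; it is integrable as the derivative of an
  -- absolutely continuous function.
  have hint : IntervalIntegrable (D (i + 1)) volume 0 Real.pi := by
    have := (hw.absolutelyContinuous_iteratedDeriv_comp (m := i) (by lia)).intervalIntegrable_deriv
    simpa only [hD, iteratedDeriv_succ] using this
  have hI : 0 ≤ ∫ t in (0 : ℝ)..Real.pi, |D (i + 1) t| :=
    intervalIntegral.integral_nonneg Real.pi_pos.le fun _ _ => abs_nonneg _
  refine ⟨1 / Real.pi * ∫ t in (0 : ℝ)..Real.pi, |D (i + 1) t|, by positivity, fun n => ?_⟩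
  rw [sineCoeff, hstep n (i + 1) le_rfl, abs_mul, abs_mul, abs_pow, abs_neg,
    abs_of_pos (by positivity : 0 < 1 / Real.pi), abs_of_pos (by positivity : 0 < 1 / ((n : ℝ) + 1 / 2))]
  have hle : |∫ t in (0 : ℝ)..Real.pi,
      Real.sin ((n + 1 / 2) * t - (i + 1 : ℕ) * (Real.pi / 2)) * D (i + 1) t| ≤
      ∫ t in (0 : ℝ)..Real.pi, |D (i + 1) t| := by
    rw [← Real.norm_eq_abs]
    refine intervalIntegral.norm_integral_le_of_norm_le (μ := volume) Real.pi_pos.le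
      (ae_of_all _ fun t _ => ?_) hint.abs
    rw [norm_mul]
    exact mul_le_of_le_one_left (norm_nonneg _) (Real.abs_sin_le_one _)
  calc 1 / Real.pi * ((1 / ((n : ℝ) + 1 / 2)) ^ (i + 1) * _)
      ≤ 1 / Real.pi * ((1 / ((n : ℝ) + 1 / 2)) ^ (i + 1) *
        ∫ t in (0 : ℝ)..Real.pi, |D (i + 1) t|) := by gcongr
    _ = _ := by ring

/-! ### Coefficients computed from data, and their sensitivity to noise. -/

lemma intervalIntegrable_comp_halfSinSq {h : ℝ → ℝ} (hh : MemLp h 2 muE) :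
    IntervalIntegrable (fun t => h (halfSinSq t)) volume 0 Real.pi := by
  rw [intervalIntegrable_iff_integrableOn_Ioo_of_le Real.pi_pos.le]
  exact measurePreserving_halfSinSq.integrable_comp_of_integrable (hh.integrable one_le_two)

/-- Folding `(-π, 0)` onto `(0, π)`, the sign in `eta` combines the exponentials into `e^{i(n+1/2)t}
- e^{-i(n+1/2)t}`, which over `2πi` is a real sine. -/
lemma gammaHat_eq_sineCoeff {h : ℝ → ℝ} (hh : MemLp h 2 muE) (n : ℕ) :
    gammaHat h n = (sineCoeff h n : ℂ) := by
  set F : ℝ → ℂ := fun t => eta h t * Complex.exp (Complex.I * n * t) with hF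
  have hneg : ∀ t, halfSinSq (-t) = halfSinSq t := fun t => by
    rw [halfSinSq, halfSinSq, neg_div, Real.sin_neg, neg_sq]
  have hpos : ∀ t ∈ Ioc 0 Real.pi, F t = (1 / (2 * Real.pi * Complex.I) *
      Complex.exp (Complex.I * t / 2) * Complex.exp (Complex.I * n * t)) * (h (halfSinSq t) : ℂ) :=
    fun t ht => by
      simp only [hF, eta, Real.sign_of_pos ht.1, halfSinSq]
      push_cast; ring
  have hposn : ∀ t ∈ Ioc 0 Real.pi, F (-t) = (-1 / (2 * Real.pi * Complex.I) *
      Complex.exp (-(Complex.I * t / 2)) * Complex.exp (-(Complex.I * n * t))) *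
        (h (halfSinSq t) : ℂ) :=
    fun t ht => by
      have : Real.sin (-t / 2) ^ 2 = halfSinSq t := hneg t
      simp only [hF, eta, Real.sign_of_neg (neg_neg_of_pos ht.1), this]
      push_cast
      rw [show Complex.I * -(t : ℂ) / 2 = -(Complex.I * t / 2) by ring,
        show Complex.I * n * -(t : ℂ) = -(Complex.I * n * t) by ring]
      ring
  have hhi : IntervalIntegrable (fun t => (h (halfSinSq t) : ℂ)) volume 0 Real.pi := by
    have := intervalIntegrable_comp_halfSinSq hh
    rw [intervalIntegrable_iff] at this ⊢
    exact this.ofReal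
  have hi1 : IntervalIntegrable F volume 0 Real.pi := by
    refine (hhi.continuousOn_mul (g := fun t : ℝ => 1 / (2 * Real.pi * Complex.I) *
      Complex.exp (Complex.I * t / 2) * Complex.exp (Complex.I * n * t)) ?_).congr ?_
    · fun_prop
    · intro t ht
      rw [uIoc_of_le Real.pi_pos.le] at ht
      exact (hpos t ht).symm
  have hi2 : IntervalIntegrable (fun t => F (-t)) volume 0 Real.pi := by
    refine (hhi.continuousOn_mul (g := fun t : ℝ => -1 / (2 * Real.pi * Complex.I) *
      Complex.exp (-(Complex.I * t / 2)) * Complex.exp (-(Complex.I * n * t))) ?_).congr ?_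
    · fun_prop
    · intro t ht
      rw [uIoc_of_le Real.pi_pos.le] at ht
      exact (hposn t ht).symm
  have hi3 : IntervalIntegrable F volume (-Real.pi) 0 := by
    rw [IntervalIntegrable.iff_comp_neg, neg_neg, neg_zero]
    exact hi2.symm
  rw [gammaHat, ← intervalIntegral.integral_add_adjacent_intervals hi3 hi1]
  have h1 : ∫ t in (-Real.pi)..0, F t = ∫ t in (0 : ℝ)..Real.pi, F (-t) := by
    rw [intervalIntegral.integral_comp_neg, neg_zero]
  rw [h1, ← intervalIntegral.integral_add hi2 hi1, sineCoeff,
    ← intervalIntegral.integral_const_mul, ← intervalIntegral.integral_ofReal]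
  rw [intervalIntegral.integral_of_le Real.pi_pos.le, intervalIntegral.integral_of_le Real.pi_pos.le]
  refine setIntegral_congr_fun measurableSet_Ioc fun t ht => ?_
  rw [hpos t ht, hposn t ht]
  push_cast
  rw [Complex.sin, mul_assoc (1 / _), ← Complex.exp_add, mul_assoc (-1 / _), ← Complex.exp_add]
  rw [show Complex.I * (t : ℂ) / 2 + Complex.I * n * t = ((n + 1 / 2) * t) * Complex.I by ring,
    show -(Complex.I * (t : ℂ) / 2) + -(Complex.I * n * t) = -((n + 1 / 2) * t) * Complex.I by ring]
  have hpi : (Real.pi : ℂ) ≠ 0 := by exact_mod_cast Real.pi_ne_zero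
  have hI := Complex.I_ne_zero
  field_simp
  rw [Complex.I_sq]
  ring

/-- Cauchy–Schwarz with total mass `π` gives the sharper bound `ε / √π`. -/
lemma abs_sineCoeff_le {h : ℝ → ℝ} {ε : ℝ} (hh : MemLp h 2 muE) (hε : 0 ≤ ε)
    (hle : eLpNorm h 2 muE ≤ ENNReal.ofReal ε) (n : ℕ) : |sineCoeff h n| ≤ ε := by
  have hi := intervalIntegrable_comp_halfSinSq hh
  have h1 : |∫ t in (0 : ℝ)..Real.pi, Real.sin ((n + 1 / 2) * t) * h (halfSinSq t)| ≤
      ∫ t in (0 : ℝ)..Real.pi, |h (halfSinSq t)| := by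
    rw [← Real.norm_eq_abs]
    refine intervalIntegral.norm_integral_le_of_norm_le (μ := volume) Real.pi_pos.le
      (ae_of_all _ fun t _ => ?_) hi.abs
    rw [norm_mul]
    exact mul_le_of_le_one_left (norm_nonneg _) (Real.abs_sin_le_one _)
  have h2 : ∫ t in (0 : ℝ)..Real.pi, |h (halfSinSq t)| = ∫ x, ‖h x‖ ∂muE :=
    (integral_muE_eq_trig (F := fun x => ‖h x‖) hh.1.norm).symm
  have h3 : ∫ x, ‖h x‖ ∂muE ≤ ε * √Real.pi := by
    rw [integral_norm_eq_lintegral_enorm hh.1, ← eLpNorm_one_eq_lintegral_enorm]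
    refine ENNReal.toReal_le_of_le_ofReal (by positivity) ?_
    refine (eLpNorm_le_eLpNorm_mul_rpow_measure_univ one_le_two hh.1).trans ?_
    rw [ENNReal.ofReal_mul hε, muE_univ, Real.sqrt_eq_rpow,
      ← ENNReal.ofReal_rpow_of_pos Real.pi_pos]
    norm_num
    gcongr
  have h4 : 1 ≤ √Real.pi := Real.one_le_sqrt.2 (by linarith [Real.pi_gt_three])
  rw [sineCoeff, abs_mul, abs_of_pos (by positivity : 0 < 1 / Real.pi)]
  calc 1 / Real.pi * _ ≤ 1 / Real.pi * (ε * √Real.pi) := by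
        gcongr; exact h1.trans (h2.le.trans h3)
    _ ≤ 1 / Real.pi * (ε * (√Real.pi * √Real.pi)) := by
        gcongr; nlinarith
    _ = ε := by
        rw [Real.mul_self_sqrt Real.pi_pos.le]
        have := Real.pi_ne_zero
        field_simp

lemma sineCoeff_sub {g h : ℝ → ℝ} (hg : MemLp g 2 muE) (hh : MemLp h 2 muE) (n : ℕ) :
    sineCoeff (fun x => g x - h x) n = sineCoeff g n - sineCoeff h n := by
  have hc : ContinuousOn (fun t : ℝ => Real.sin (((n : ℝ) + 1 / 2) * t)) (uIcc 0 Real.pi) := by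
    fun_prop
  rw [sineCoeff, sineCoeff, sineCoeff, ← mul_sub, ← intervalIntegral.integral_sub
    ((intervalIntegrable_comp_halfSinSq hg).continuousOn_mul hc)
    ((intervalIntegrable_comp_halfSinSq hh).continuousOn_mul hc)]
  simp only [mul_sub]

/-- The real Legendre coefficient computed from the data. -/
def dataCoeff (h : ℝ → ℝ) (n : ℕ) : ℝ := (-1) ^ n * √(2 * n + 1) * sineCoeff h n

lemma legendreCoeff_eq {h : ℝ → ℝ} (hh : MemLp h 2 muE) (n : ℕ) :
    legendreCoeff h n = (dataCoeff h n : ℂ) := by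
  rw [legendreCoeff, gammaHat_eq_sineCoeff hh, dataCoeff]
  push_cast
  rfl

lemma eLpNorm_sub_reconstruction {f h : ℝ → ℝ} (hh : MemLp h 2 muE) (N : ℕ) :
    eLpNorm (fun x => (f x : ℂ) - reconstruction h N x) 2 volE =
      eLpNorm (fun x => f x - ∑ n ∈ Finset.range (N + 1), dataCoeff h n * legendreBar n x) 2
        volE := by
  refine eLpNorm_congr_norm_ae (ae_of_all _ fun x => ?_)
  rw [← Complex.norm_real]
  congr 1
  simp only [reconstruction, legendreCoeff_eq hh]
  push_cast
  rfl

lemma integral_legendreBar_eq_dataCoeff {f g : ℝ → ℝ} (hf : Integrable f volE)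
    (hfg : ∀ x ∈ Icc (0 : ℝ) 1, g x = abelTransform f x) (n : ℕ) :
    ∫ x, f x * legendreBar n x ∂volE = dataCoeff g n := by
  have h1 : ∀ x, f x * legendreBar n x = √(2 * n + 1) * (f x * legendreP n (2 * x - 1)) :=
    fun x => by rw [legendreBar]; ring
  have hs : ((-1 : ℝ) ^ n) * (-1) ^ n = 1 := by rw [← mul_pow]; simp
  simp only [h1]
  rw [integral_const_mul, dataCoeff, sineCoeff_abelTransform hf hfg]
  linear_combination (-(√(2 * (n : ℝ) + 1) * ∫ x, f x * legendreP n (2 * x - 1) ∂volE)) * hs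

/-! ### Truncation error and the choice of the cut-off. -/

lemma sum_tail_le (r N M : ℕ) :
    ∑ n ∈ Finset.range M, (2 * ((N + 1 + n : ℕ) : ℝ) + 1) *
        ((1 / (((N + 1 + n : ℕ) : ℝ) + 1 / 2)) ^ (r + 2)) ^ 2 ≤
      ((1 / ((N : ℝ) + 1)) ^ (r + 1)) ^ 2 := by
  set ρ : ℝ := 1 / ((N : ℝ) + 1) with hρ
  have hρ0 : 0 < ρ := by positivity
  -- The subtracted term makes the bound telescope, so that induction on `M` closes.
  suffices h : ∑ n ∈ Finset.range M, (2 * ((N + 1 + n : ℕ) : ℝ) + 1) *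
        ((1 / (((N + 1 + n : ℕ) : ℝ) + 1 / 2)) ^ (r + 2)) ^ 2 ≤
      (ρ ^ r) ^ 2 * (ρ ^ 2 - 1 / ((N : ℝ) + 1 + M) ^ 2) by
    refine h.trans ?_
    rw [pow_succ ρ r, mul_pow]
    gcongr
    exact sub_le_self _ (by positivity)
  induction M with
  | zero => simp [hρ]
  | succ M ih =>
    rw [Finset.sum_range_succ]
    set y : ℝ := (N : ℝ) + 1 + M with hy
    have hy1 : (N : ℝ) + 1 ≤ y := by rw [hy]; linarith [Nat.cast_nonneg (α := ℝ) M]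
    have hy0 : 0 < y := by positivity
    have hcast : ((N + 1 + M : ℕ) : ℝ) = y := by push_cast; rfl
    rw [hcast]
    have h1 : 1 / (y + 1 / 2) ≤ ρ := by
      exact one_div_le_one_div_of_le (by positivity) (by linarith)
    -- Here `2y + 1 = (y + 1)² - y²` and `y (y + 1) ≤ (y + 1/2)²`.
    have h2 : (2 * y + 1) * (1 / (y + 1 / 2)) ^ 4 ≤ 1 / y ^ 2 - 1 / (y + 1) ^ 2 := by
      rw [div_sub_div _ _ (by positivity) (by positivity), div_pow, one_pow, mul_one_div,
        div_le_div_iff₀ (by positivity) (by positivity)]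
      have hz : 0 ≤ y ^ 2 + y := by positivity
      have e1 : (y + 1 / 2) ^ 4 = (y ^ 2 + y + 1 / 4) ^ 2 := by ring
      have e2 : y ^ 2 * (y + 1) ^ 2 = (y ^ 2 + y) ^ 2 := by ring
      rw [e1, e2]
      have : (y ^ 2 + y) ^ 2 ≤ (y ^ 2 + y + 1 / 4) ^ 2 :=
        pow_le_pow_left₀ hz (by linarith) 2
      nlinarith
    have h3 : (2 * y + 1) * ((1 / (y + 1 / 2)) ^ (r + 2)) ^ 2 ≤
        (ρ ^ r) ^ 2 * (1 / y ^ 2 - 1 / (y + 1) ^ 2) := by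
      calc (2 * y + 1) * ((1 / (y + 1 / 2)) ^ (r + 2)) ^ 2
          = ((1 / (y + 1 / 2)) ^ r) ^ 2 * ((2 * y + 1) * (1 / (y + 1 / 2)) ^ 4) := by ring
        _ ≤ (ρ ^ r) ^ 2 * (1 / y ^ 2 - 1 / (y + 1) ^ 2) := by gcongr
    have h4 : (N : ℝ) + 1 + ((M + 1 : ℕ) : ℝ) = y + 1 := by push_cast; rw [hy]; ring
    rw [h4]
    linarith

lemma sum_odd_range (N : ℕ) : ∑ n ∈ Finset.range N, (2 * (n : ℝ) + 1) = (N : ℝ) ^ 2 := by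
  induction N with
  | zero => simp
  | succ N ih => rw [Finset.sum_range_succ, ih]; push_cast; ring

/-- Error bound for the spectral cut-off in terms of the cut-off index and the noise level. -/
lemma eLpNorm_error_le {f g h : ℝ → ℝ} {r : ℕ} {C ε : ℝ} (hf : MemLp f 2 volE)
    (hfg : ∀ x ∈ Icc (0 : ℝ) 1, g x = abelTransform f x) (hC : 0 ≤ C) (hε : 0 ≤ ε)
    (hdecay : ∀ n : ℕ, |sineCoeff g n| ≤ C * (1 / (n + 1 / 2)) ^ (r + 2))
    (hnoise : ∀ n, |sineCoeff g n - sineCoeff h n| ≤ ε) (N : ℕ) :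
    eLpNorm (fun x => f x - ∑ n ∈ Finset.range (N + 1), dataCoeff h n * legendreBar n x) 2 volE ≤
      ENNReal.ofReal ((N + 1) * ε + C * (1 / ((N : ℝ) + 1)) ^ (r + 1)) := by
  refine eLpNorm_sub_legendreSum_le hf _ N (by positivity) fun M => ?_
  simp only [integral_legendreBar_eq_dataCoeff (hf.integrable one_le_two) hfg]
  have hsq : ∀ (n : ℕ) (s : ℝ), ((-1) ^ n * √(2 * (n : ℝ) + 1) * s) ^ 2 = (2 * n + 1) * s ^ 2 :=
    fun n s => by
      rw [mul_pow, mul_pow, Real.sq_sqrt (by positivity), ← pow_mul, mul_comm n, pow_mul]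
      simp
  calc ∑ n ∈ Finset.range M, (dataCoeff g n - if n < N + 1 then dataCoeff h n else 0) ^ 2
      ≤ ∑ n ∈ Finset.range (N + 1 + M),
          (dataCoeff g n - if n < N + 1 then dataCoeff h n else 0) ^ 2 :=
        Finset.sum_le_sum_of_subset_of_nonneg (Finset.range_subset_range.2 (by lia))
          fun _ _ _ => sq_nonneg _
    _ = ∑ n ∈ Finset.range (N + 1),
          (dataCoeff g n - if n < N + 1 then dataCoeff h n else 0) ^ 2 +
        ∑ n ∈ Finset.range M, (dataCoeff g (N + 1 + n) -
          if N + 1 + n < N + 1 then dataCoeff h (N + 1 + n) else 0) ^ 2 :=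
        Finset.sum_range_add _ _ _
    _ ≤ ∑ n ∈ Finset.range (N + 1), (2 * (n : ℝ) + 1) * ε ^ 2 +
        ∑ n ∈ Finset.range M, C ^ 2 * ((2 * ((N + 1 + n : ℕ) : ℝ) + 1) *
          ((1 / (((N + 1 + n : ℕ) : ℝ) + 1 / 2)) ^ (r + 2)) ^ 2) := by
        gcongr with n hn n hn
        · rw [if_pos (Finset.mem_range.1 hn), dataCoeff, dataCoeff, ← mul_sub, hsq]
          have := sq_le_sq' (abs_le.1 (hnoise n)).1 (abs_le.1 (hnoise n)).2
          gcongr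
        · rw [if_neg (by lia), sub_zero, dataCoeff, hsq]
          have h1 := hdecay (N + 1 + n)
          have h2 := sq_le_sq' (abs_le.1 h1).1 (abs_le.1 h1).2
          calc _ ≤ (2 * ((N + 1 + n : ℕ) : ℝ) + 1) *
                (C * (1 / (((N + 1 + n : ℕ) : ℝ) + 1 / 2)) ^ (r + 2)) ^ 2 := by gcongr
            _ = _ := by ring
    _ ≤ ((N + 1) * ε) ^ 2 + C ^ 2 * ((1 / ((N : ℝ) + 1)) ^ (r + 1)) ^ 2 := by
        rw [← Finset.sum_mul, sum_odd_range, ← Finset.mul_sum, mul_pow]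
        push_cast
        gcongr
        have := sum_tail_le r N M
        push_cast at this
        exact this
    _ ≤ ((N + 1) * ε + C * (1 / ((N : ℝ) + 1)) ^ (r + 1)) ^ 2 := by
        have h1 : 0 ≤ ((N : ℝ) + 1) * ε := by positivity
        have h2 : 0 ≤ C * (1 / ((N : ℝ) + 1)) ^ (r + 1) := by positivity
        nlinarith [mul_nonneg h1 h2]

lemma error_rate_le {r N : ℕ} {c C ε : ℝ} (hc : 0 < c) (hC : 0 ≤ C) (hε : 0 < ε) (hε1 : ε ≤ 1)
    (hN : |(N : ℝ) - c * ε ^ (-(1 / ((r + 2 : ℕ) : ℝ)))| ≤ 1) :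
    (N + 1) * ε + C * (1 / ((N : ℝ) + 1)) ^ (r + 1) ≤
      (c + 2 + C / c ^ (r + 1)) * ε ^ ((((r + 2 : ℕ) : ℝ) - 1) / ((r + 2 : ℕ) : ℝ)) := by
  set δ := ε ^ (1 / ((r + 2 : ℕ) : ℝ)) with hδ
  have hk0 : ((r + 2 : ℕ) : ℝ) ≠ 0 := by positivity
  have hδ0 : 0 < δ := Real.rpow_pos_of_pos hε _
  have hδ1 : δ ≤ 1 := Real.rpow_le_one hε.le hε1 (by positivity)
  have h1 : ε ^ (-(1 / ((r + 2 : ℕ) : ℝ))) = 1 / δ := by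
    rw [Real.rpow_neg hε.le]
    exact (one_div δ).symm
  have h2 : ε = δ ^ (r + 2) := by
    rw [hδ, ← Real.rpow_natCast, ← Real.rpow_mul hε.le, one_div_mul_cancel hk0, Real.rpow_one]
  have h3 : ε ^ ((((r + 2 : ℕ) : ℝ) - 1) / ((r + 2 : ℕ) : ℝ)) = δ ^ (r + 1) := by
    rw [hδ, ← Real.rpow_natCast, ← Real.rpow_mul hε.le]
    congr 1
    push_cast
    ring
  rw [h1] at hN
  obtain ⟨hN1, hN2⟩ := abs_le.1 hN
  -- One unit comes from rounding and one from `N + 1`; both are absorbed by `1 ≤ 1 / δ`. For the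
  -- lower bound on `N + 1`, the added one exactly offsets the rounding.
  have h4 : (N : ℝ) + 1 ≤ (c + 2) / δ := by
    have : 1 ≤ 1 / δ := by rwa [le_div_iff₀ hδ0, one_mul]
    rw [show (c + 2) / δ = c * (1 / δ) + 2 * (1 / δ) by ring]
    linarith
  have h5 : 1 / ((N : ℝ) + 1) ≤ δ / c := by
    rw [div_le_div_iff₀ (by positivity) hc, one_mul]
    have : c = δ * (c * (1 / δ)) := by field_simp
    rw [this]
    gcongr
    linarith
  rw [h3]
  calc (N + 1) * ε + C * (1 / ((N : ℝ) + 1)) ^ (r + 1)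
      ≤ (c + 2) / δ * ε + C * (δ / c) ^ (r + 1) := by gcongr
    _ = (c + 2 + C / c ^ (r + 1)) * δ ^ (r + 1) := by
        rw [h2, div_pow, pow_succ δ (r + 1)]
        field_simp

end AbelInversion

end

/-! ### The convergence rate. -/

theorem mainTheorem5 (k : ℕ) (hk : 1 < k) (c : ℝ) (hc : 0 < c) (f g : ℝ → ℝ)
    (hf : MemLp f 2 AbelInversion.volE)
    (hfg : ∀ x ∈ Icc (0 : ℝ) 1, g x = AbelInversion.abelTransform f x)
    (hg : AbelInversion.MemSobolevMu k g)
    (hvanish : ∀ j < k,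
      Tendsto (iteratedDeriv j fun t : ℝ => g (Real.sin (t / 2) ^ 2)) (𝓝[≠] 0) (𝓝 0)) :
    ∃ C > (0 : ℝ), ∃ ε₀ > (0 : ℝ), ∀ ε : ℝ, 0 < ε → ε ≤ ε₀ →
      ∀ gε : ℝ → ℝ, AEStronglyMeasurable gε AbelInversion.muE →
        eLpNorm (fun x => g x - gε x) 2 AbelInversion.muE ≤ ENNReal.ofReal ε →
        ∀ N : ℕ, |(N : ℝ) - c * ε ^ (-(1 / (k : ℝ)))| ≤ 1 →
          eLpNorm (fun x => (f x : ℂ) - AbelInversion.reconstruction gε N x) 2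
              AbelInversion.volE
            ≤ ENNReal.ofReal (C * ε ^ (((k : ℝ) - 1) / k)) := by
  open AbelInversion in
  obtain ⟨r, rfl⟩ : ∃ r, k = r + 2 := ⟨k - 2, by lia⟩
  have hfi : Integrable f volE := hf.integrable one_le_two
  obtain ⟨w, hw, hgw⟩ := exists_chain_of_memSobolevMu hg
  have hw0 : w 0 0 = 0 := by
    refine representative_zero (hw.continuous (by lia)) hgw ?_
    simpa [halfSinSq] using hvanish 0 (by lia)
  have hprim : ∀ x, w 0 x = ∫ y in (0 : ℝ)..x, w 1 y := fun x => by
    have := hw.2 0 (by lia) x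
    rwa [hw0, zero_add] at this
  have hw1 : Integrable (w 1) volE := by
    have := hw.intervalIntegrable (j := 1) (by lia) 0 1
    rwa [intervalIntegrable_iff_integrableOn_Ioo_of_le zero_le_one] at this
  -- Equality everywhere, not just a.e., is needed to transfer the vanishing limits from `g` to `w
  -- 0`.
  have hgeq : ∀ x ∈ Icc (0 : ℝ) 1, g x = w 0 x := fun x hx => by
    rw [hfg x hx, hprim]
    refine abelTransform_eq_primitive hfi hw1 ?_ hx
    filter_upwards [hgw, ae_volE_mem] with y hy hym
    rw [← hfg y (Ioo_subset_Icc_self hym), hy, hprim]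
  have hcomp : (fun t : ℝ => g (Real.sin (t / 2) ^ 2)) = fun t => w 0 (halfSinSq t) :=
    funext fun t => hgeq _ (halfSinSq_mem_Icc t)
  rw [hcomp] at hvanish
  -- The derivatives of order below `k` are continuous, so their punctured limits at `0` are their
  -- values.
  obtain ⟨C, hC, hdecay⟩ := hw.sineCoeff_decay (by lia) fun j hj =>
    tendsto_nhds_unique
      (((hw.continuous_iteratedDeriv_comp hj).tendsto 0).mono_left nhdsWithin_le_nhds)
      (hvanish j hj)
  have hsine : ∀ n, sineCoeff g n = sineCoeff (w 0) n := fun n => by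
    simp only [sineCoeff, hgeq _ (halfSinSq_mem_Icc _)]
  -- The threshold `ε₀ = 1` ensures `ε^{1/k} ≤ 1`, as the rounding estimate requires.
  refine ⟨c + 2 + C / c ^ (r + 1), by positivity, 1, one_pos, fun ε hε hε1 gε hgε hle N hN => ?_⟩
  have hdiff : MemLp (fun x => g x - gε x) 2 muE :=
    ⟨hg.1.1.sub hgε, hle.trans_lt ENNReal.ofReal_lt_top⟩
  have hgεL : MemLp gε 2 muE := by
    have := hg.1.sub hdiff
    refine this.ae_eq (ae_of_all _ fun x => ?_)
    simp
  rw [eLpNorm_sub_reconstruction hgεL]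
  refine (eLpNorm_error_le (r := r) hf hfg hC hε.le (fun n => hsine n ▸ hdecay n)
    (fun n => ?_) N).trans (ENNReal.ofReal_le_ofReal (error_rate_le hc hC hε hε1 hN))
  rw [← sineCoeff_sub hg.1 hgεL]
  exact abs_sineCoeff_le hdiff hε.le hle n
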